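/- **Conventions.** Fix $\mathbf x=(x_i)\in[0,1]^{\mathbb N}$. A *$k$-labelled multigraph* is a finite multigraph (multiple edges allowed, no loops) together with an injective labelling of some of its nodes by $k$ labels $1,\dots,k$ (all labels used), without unlabelled isolated nodes; it is identified with the $(k+1)$-labelled multigraph obtained by adding an isolated node with label $k+1$. Let $\mathcal H_{n,k}$ be the finite set of isomorphism classes of $k$-labelled multigraphs with $n$ edges. The product $H_1H_2$ is the disjoint union followed by identification of equally labelled nodes. $\mathcal Q_{\mathbb N}$ is the real algebra with basis $\bigcup_{k}\bigsqcup_n\mathcal H_{n,k}$ and this product. $\widehat{\mathcal Q}_k=\prod_n\mathbb R^{\mathcal H_{n,k}}$ is the algebra of formal series $F=\sum_{n}\sum_{H\in\mathcal H_{n,k}}a_HH$ with the Cauchy product, with the topology of coefficientwise convergence. The radius of convergence $R_F\in[0,\infty]$ of $F$ is given by $R_F^{-1}=\limsup_n\big(\sum_{H\in\mathcal H_{n,k}}|a_H|\big)^{1/n}$. For $0<R\le\infty$ let $\mathcal Q_{k,R}$ be the set of $F\in\widehat{\mathcal Q}_k$ with $R_F>R$ (with $R_F=\infty$, if $R=\infty$),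 and $\mathcal Q_{\mathbb N,R}=\bigcup_k\mathcal Q_{k,R}$, an algebra that contains $\mathcal Q_{\mathbb N}$. For $s>0$ let $\mathcal W_{[-s,s]}$ be the set of symmetric (Borel) measurable functions $f:[0,1]^2\to[-s,s]$. For a $k$-labelled multigraph $H$ with set $V_0$ of unlabelled nodes put $$t_{\mathbf x}(H,f)=\int_{[0,1]^{V_0}}\prod_{e\in E(H)}f(x_{e_s},x_{e_t})\prod_{v\in V_0}dx_v ,$$ where $e_s,e_t$ are the end points of $e$, and $x_v=\mathbf x_i$ if $v$ is the node with label $i$. Let $\alpha_{\mathbf x}:\mathcal Q_{\mathbb N}\to \mathrm{Func}(\mathcal W_{[-s,s]},\mathbb R)$ be the algebra homomorphism with $\alpha_{\mathbf x}(H)=t_{\mathbf x}(H,-)$. **Theorem.** Let $\mathbf x\in[0,1]^{\mathbb N}$ and $0<s<R\le\infty$. Then $\alpha_{\mathbf x}$ extends to a homomorphism of $\mathbb R$-algebras $\widehat\alpha_{\mathbf x}:\mathcal Q_{\mathbb N,R}\to\mathrm{Func}(\mathcal W_{[-s,s]},\mathbb R)$ with the following properties. 1. For every $k$ and every $F=\sum_n\sum_{H\in\mathcal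 H_{n,k}}a_HH\in\mathcal Q_{k,R}$, the functions $\sum_{n<N}\sum_{H\in\mathcal H_{n,k}}a_H\,t_{\mathbf x}(H,-)$ converge to $\widehat\alpha_{\mathbf x}(F)$ as $N\to\infty$, uniformly on $\mathcal W_{[-s,s]}$. (In particular, these conditions determine $\widehat\alpha_{\mathbf x}$.) 2. For every $k$, every $r>s$ and every $C$, the map $\widehat\alpha_{\mathbf x}$ is continuous, from the topology of $\widehat{\mathcal Q}_k$ to that of uniform convergence in $\mathrm{Func}(\mathcal W_{[-s,s]},\mathbb R)$, on the set of all $F\in\mathcal Q_{k,R}$ with $\sum_{n}\sum_{H\in\mathcal H_{n,k}}|a_H|\,r^{n}\le C$. 3. $\widehat\alpha_{\mathbf x}$ is injective if and only if the entries of $\mathbf x$ are pairwise distinct; the same equivalence holds for $\alpha_{\mathbf x}$ on $\mathcal Q_{\mathbb N}$. -/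

import Mathlib

open MeasureTheory Filter Topology
open scoped ENNReal

/-! ## Partially labelled multigraphs -/

/-- A partially labelled multigraph without loops: the vertex set is `ℕ ⊕ V`, where `Sum.inl i`
is the node with label `i` and `V` is the finite set of unlabelled nodes; `E` is the finite set of
edges, and `ends e` is the unordered pair of end points of the edge `e`.
No unlabelled node is isolated.

A `k`-labelled multigraph is identified with all the multigraphs obtained from it by attaching
isolated nodes with labels `≥ k`; thus a `k`-labelled multigraph is one in which all nodes with a
label `≥ k` are isolated (`PLMultigraph.IsLabelledBy`), and this type is the union over all `k`. -/
structure PLMultigraph : Type 1 where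
  V : Type
  E : Type
  fintypeV : Fintype V
  fintypeE : Fintype E
  ends : E → Sym2 (ℕ ⊕ V)
  loopless : ∀ e, ¬ (ends e).IsDiag
  covered : ∀ v : V, ∃ e, Sum.inr v ∈ ends e

namespace PLMultigraph

attribute [instance] PLMultigraph.fintypeV PLMultigraph.fintypeE

/-- Isomorphism: bijections of the unlabelled nodes and of the edges, compatible with end points,
and fixing every label. -/
def Iso (G H : PLMultigraph) : Prop :=
  ∃ (σ : G.V ≃ H.V) (τ : G.E ≃ H.E),
    ∀ e, H.ends (τ e) = (G.ends e).map (Sum.map id σ)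

theorem Iso.refl (G : PLMultigraph) : G.Iso G :=
  ⟨Equiv.refl _, Equiv.refl _, fun e => by simp⟩

theorem Iso.symm {G H : PLMultigraph} : G.Iso H → H.Iso G := by
  rintro ⟨σ, τ, h⟩
  refine ⟨σ.symm, τ.symm, fun e => ?_⟩
  have := h (τ.symm e)
  rw [Equiv.apply_symm_apply] at this
  rw [this, Sym2.map_map, Sum.map_comp_map]
  simp

theorem Iso.trans {G H K : PLMultigraph} : G.Iso H → H.Iso K → G.Iso K := by
  rintro ⟨σ, τ, h⟩ ⟨σ', τ', h'⟩
  refine ⟨σ.trans σ', τ.trans τ', fun e => ?_⟩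
  rw [Equiv.trans_apply, h', h, Sym2.map_map, Sum.map_comp_map]
  rfl

instance setoid : Setoid PLMultigraph :=
  ⟨Iso, Iso.refl, Iso.symm, Iso.trans⟩

/-- All nodes with a label `≥ k` are isolated. -/
def IsLabelledBy (k : ℕ) (G : PLMultigraph) : Prop :=
  ∀ e i, Sum.inl i ∈ G.ends e → i < k

/-- The number of edges. -/
def edgeCount (G : PLMultigraph) : ℕ := Fintype.card G.E

/-- The multigraph without edges and unlabelled nodes. -/
def empty : PLMultigraph where
  V := Empty
  E := Empty
  fintypeV := inferInstance
  fintypeE := inferInstance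
  ends := Empty.elim
  loopless := fun e => e.elim
  covered := fun v => v.elim

/-- Disjoint union, followed by identification of equally labelled nodes. -/
def glue (G H : PLMultigraph) : PLMultigraph where
  V := G.V ⊕ H.V
  E := G.E ⊕ H.E
  fintypeV := inferInstance
  fintypeE := inferInstance
  ends := Sum.elim (fun e => (G.ends e).map (Sum.map id Sum.inl))
    (fun e => (H.ends e).map (Sum.map id Sum.inr))
  loopless := by
    have key : ∀ {α β : Type} (f : α → β) (_ : Function.Injective f) (z : Sym2 α),
        ¬ z.IsDiag → ¬ (z.map f).IsDiag := by
      intro α β f hf z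
      induction z with | _ a b => simp [hf.eq_iff]
    rintro (e | e)
    · exact key _ (Sum.map_injective.2 ⟨Function.injective_id, Sum.inl_injective⟩) _ (G.loopless e)
    · exact key _ (Sum.map_injective.2 ⟨Function.injective_id, Sum.inr_injective⟩) _ (H.loopless e)
  covered := by
    rintro (v | v)
    · obtain ⟨e, he⟩ := G.covered v
      exact ⟨Sum.inl e, Sym2.mem_map.2 ⟨_, he, rfl⟩⟩
    · obtain ⟨e, he⟩ := H.covered v
      exact ⟨Sum.inr e, Sym2.mem_map.2 ⟨_, he, rfl⟩⟩

theorem glue_iso {G G' H H' : PLMultigraph} :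
    G.Iso G' → H.Iso H' → (G.glue H).Iso (G'.glue H') := by
  rintro ⟨σ, τ, h⟩ ⟨σ', τ', h'⟩
  refine ⟨Equiv.sumCongr σ σ', Equiv.sumCongr τ τ', ?_⟩
  rintro (e | e)
  · change (G'.ends (τ e)).map (Sum.map id Sum.inl) =
      ((G.ends e).map (Sum.map id Sum.inl)).map (Sum.map id (Equiv.sumCongr σ σ'))
    rw [h, Sym2.map_map, Sym2.map_map]
    exact Sym2.map_congr (by rintro (i | v) _ <;> rfl)
  · change (H'.ends (τ' e)).map (Sum.map id Sum.inr) =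
      ((H.ends e).map (Sum.map id Sum.inr)).map (Sum.map id (Equiv.sumCongr σ σ'))
    rw [h', Sym2.map_map, Sym2.map_map]
    exact Sym2.map_congr (by rintro (i | v) _ <;> rfl)

theorem glue_comm (G H : PLMultigraph) : (G.glue H).Iso (H.glue G) := by
  refine ⟨Equiv.sumComm _ _, Equiv.sumComm _ _, ?_⟩
  rintro (e | e)
  · change (G.ends e).map (Sum.map id Sum.inr) =
      ((G.ends e).map (Sum.map id Sum.inl)).map (Sum.map id (Equiv.sumComm G.V H.V))
    rw [Sym2.map_map]
    exact Sym2.map_congr (by rintro (i | v) _ <;> rfl)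
  · change (H.ends e).map (Sum.map id Sum.inl) =
      ((H.ends e).map (Sum.map id Sum.inr)).map (Sum.map id (Equiv.sumComm G.V H.V))
    rw [Sym2.map_map]
    exact Sym2.map_congr (by rintro (i | v) _ <;> rfl)

theorem glue_assoc (G H K : PLMultigraph) :
    ((G.glue H).glue K).Iso (G.glue (H.glue K)) := by
  refine ⟨Equiv.sumAssoc _ _ _, Equiv.sumAssoc _ _ _, ?_⟩
  rintro ((e | e) | e)
  · change (G.ends e).map (Sum.map id Sum.inl) =
      (((G.ends e).map (Sum.map id Sum.inl)).map (Sum.map id Sum.inl)).map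
        (Sum.map id (Equiv.sumAssoc G.V H.V K.V))
    rw [Sym2.map_map, Sym2.map_map]
    exact Sym2.map_congr (by rintro (i | v) _ <;> rfl)
  · change ((H.ends e).map (Sum.map id Sum.inl)).map (Sum.map id Sum.inr) =
      (((H.ends e).map (Sum.map id Sum.inr)).map (Sum.map id Sum.inl)).map
        (Sum.map id (Equiv.sumAssoc G.V H.V K.V))
    rw [Sym2.map_map, Sym2.map_map, Sym2.map_map]
    exact Sym2.map_congr (by rintro (i | v) _ <;> rfl)
  · change ((K.ends e).map (Sum.map id Sum.inr)).map (Sum.map id Sum.inr) =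
      ((K.ends e).map (Sum.map id Sum.inr)).map (Sum.map id (Equiv.sumAssoc G.V H.V K.V))
    rw [Sym2.map_map, Sym2.map_map]
    exact Sym2.map_congr (by rintro (i | v) _ <;> rfl)

theorem empty_glue (G : PLMultigraph) : (empty.glue G).Iso G := by
  refine ⟨Equiv.emptySum Empty _, Equiv.emptySum Empty _, ?_⟩
  rintro (e | e)
  · exact e.elim
  · change G.ends e =
      ((G.ends e).map (Sum.map id Sum.inr)).map (Sum.map id (Equiv.emptySum Empty G.V))
    rw [Sym2.map_map]
    conv_lhs => rw [← id_eq (G.ends e), ← Sym2.map_id]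
    exact Sym2.map_congr (by rintro (i | v) _ <;> rfl)

end PLMultigraph

/-- Isomorphism classes of partially labelled multigraphs. -/
def MultigraphClass : Type 1 := Quotient PLMultigraph.setoid

namespace MultigraphClass

/-- The isomorphism class of a multigraph. -/
def mk (G : PLMultigraph) : MultigraphClass := Quotient.mk _ G

/-- Classes are multiplied by gluing along equally labelled nodes. -/
instance : CommMonoid MultigraphClass where
  mul := Quotient.map₂ PLMultigraph.glue fun _ _ h _ _ h' => PLMultigraph.glue_iso h h'
  one := mk PLMultigraph.empty
  mul_assoc := by
    rintro ⟨G⟩ ⟨H⟩ ⟨K⟩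
    exact Quotient.sound (PLMultigraph.glue_assoc G H K)
  mul_comm := by
    rintro ⟨G⟩ ⟨H⟩
    exact Quotient.sound (PLMultigraph.glue_comm G H)
  one_mul := by
    rintro ⟨G⟩
    exact Quotient.sound (PLMultigraph.empty_glue G)
  mul_one := by
    rintro ⟨G⟩
    exact Quotient.sound ((PLMultigraph.glue_comm _ _).trans (PLMultigraph.empty_glue G))

/-- The number of edges of a class. -/
def edgeCount : MultigraphClass → ℕ :=
  Quotient.lift PLMultigraph.edgeCount fun _ _ ⟨_, τ, _⟩ => Fintype.card_congr τ

/-- The class consists of `k`-labelled multigraphs. -/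
def IsLabelledBy (k : ℕ) : MultigraphClass → Prop :=
  Quotient.lift (PLMultigraph.IsLabelledBy k) (by
    have key : ∀ {G H : PLMultigraph}, G.Iso H → G.IsLabelledBy k → H.IsLabelledBy k := by
      rintro G H ⟨σ, τ, h⟩ hG e i hi
      obtain ⟨e, rfl⟩ := τ.surjective e
      rw [h, Sym2.mem_map] at hi
      obtain ⟨a | a, ha, hai⟩ := hi
      · obtain rfl : a = i := Sum.inl_injective hai
        exact hG _ _ ha
      · simp at hai
    exact fun G H h => propext ⟨key h, key (PLMultigraph.Iso.symm h)⟩)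

theorem edgeCount_mul (A B : MultigraphClass) :
    (A * B).edgeCount = A.edgeCount + B.edgeCount := by
  obtain ⟨G⟩ := A
  obtain ⟨H⟩ := B
  exact Fintype.card_sum

theorem edgeCount_one : (1 : MultigraphClass).edgeCount = 0 :=
  Fintype.card_eq_zero (α := Empty)

theorem isLabelledBy_one (k : ℕ) : (1 : MultigraphClass).IsLabelledBy k :=
  fun e => e.elim

theorem isLabelledBy_mul {k : ℕ} {A B : MultigraphClass} :
    (A * B).IsLabelledBy k ↔ A.IsLabelledBy k ∧ B.IsLabelledBy k := by
  obtain ⟨G⟩ := A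
  obtain ⟨H⟩ := B
  change (G.glue H).IsLabelledBy k ↔ G.IsLabelledBy k ∧ H.IsLabelledBy k
  constructor
  · intro h
    exact ⟨fun e i hi => h (Sum.inl e) i (Sym2.mem_map.2 ⟨_, hi, rfl⟩),
      fun e i hi => h (Sum.inr e) i (Sym2.mem_map.2 ⟨_, hi, rfl⟩)⟩
  · rintro ⟨hG, hH⟩ (e | e) i hi
    · obtain ⟨a | a, ha, hai⟩ := Sym2.mem_map.1 hi
      · obtain rfl : a = i := Sum.inl_injective hai
        exact hG _ _ ha
      · simp at hai
    · obtain ⟨a | a, ha, hai⟩ := Sym2.mem_map.1 hi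
      · obtain rfl : a = i := Sum.inl_injective hai
        exact hH _ _ ha
      · simp at hai

theorem IsLabelledBy.mono {k l : ℕ} (hkl : k ≤ l) {A : MultigraphClass}
    (h : A.IsLabelledBy k) : A.IsLabelledBy l := by
  obtain ⟨G⟩ := A
  exact fun e i hi => (h e i hi).trans_le hkl

theorem exists_isLabelledBy (A : MultigraphClass) : ∃ k, A.IsLabelledBy k := by
  obtain ⟨G⟩ := A
  have hfin : {i : ℕ | ∃ e, Sum.inl i ∈ G.ends e}.Finite := by
    have : {i : ℕ | ∃ e, Sum.inl i ∈ G.ends e} =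
        ⋃ e, {i : ℕ | (Sum.inl i : ℕ ⊕ G.V) ∈ G.ends e} := by
      ext i; simp
    rw [this]
    refine Set.finite_iUnion fun e => ?_
    generalize G.ends e = z
    induction z with | _ a b =>
    refine (((Set.finite_singleton a).union (Set.finite_singleton b)).preimage
      (f := Sum.inl) Sum.inl_injective.injOn).subset ?_
    intro i hi
    have hi' := Sym2.mem_iff.1 hi
    rcases hi' with h | h
    · exact Or.inl h
    · exact Or.inr h
  obtain ⟨k, hk⟩ := hfin.bddAbove
  exact ⟨k + 1, fun e i hi => Nat.lt_succ_of_le (hk ⟨e, hi⟩)⟩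

theorem card_V_le (G : PLMultigraph) : Fintype.card G.V ≤ 2 * G.edgeCount := by
  classical
  have hsub : (Finset.univ : Finset G.V) ⊆
      (Finset.univ : Finset G.E).biUnion
        fun e => Finset.univ.filter fun v => Sum.inr v ∈ G.ends e := by
    intro v _
    obtain ⟨e, he⟩ := G.covered v
    simpa using ⟨e, he⟩
  have hcard : ∀ e ∈ (Finset.univ : Finset G.E),
      (Finset.univ.filter fun v => (Sum.inr v : ℕ ⊕ G.V) ∈ G.ends e).card ≤ 2 := by
    intro e _
    generalize G.ends e = z
    induction z with | _ a b =>
    rw [← Finset.card_image_of_injective _ (Sum.inr_injective (α := ℕ))]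
    refine (Finset.card_le_card (t := {a, b}) ?_).trans Finset.card_le_two
    intro w hw
    simp only [Finset.mem_image, Finset.mem_filter] at hw
    obtain ⟨v, ⟨-, hv⟩, rfl⟩ := hw
    simpa using hv
  calc Fintype.card G.V ≤ _ := Finset.card_le_card hsub
    _ ≤ Finset.card (Finset.univ : Finset G.E) * 2 := Finset.card_biUnion_le_card_mul _ _ _ hcard
    _ = 2 * G.edgeCount := by rw [mul_comm]; rfl

/-- There are only finitely many `k`-labelled classes with `n` edges. -/
theorem finite_classes (n k : ℕ) :
    {H : MultigraphClass | H.edgeCount = n ∧ H.IsLabelledBy k}.Finite := by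
  classical
  have hS : ∀ m : ℕ, {z : Sym2 (ℕ ⊕ Fin m) | ∀ i, Sum.inl i ∈ z → i < k}.Finite := by
    intro m
    have hT : (Sum.inl '' Set.Iio k ∪ Set.range Sum.inr : Set (ℕ ⊕ Fin m)).Finite :=
      ((Set.finite_Iio k).image _).union (Set.finite_range _)
    refine (Set.Finite.image2 (fun a b => s(a, b)) hT hT).subset ?_
    intro z hz
    induction z with | _ a b =>
    have aux : ∀ c : ℕ ⊕ Fin m, c ∈ s(a, b) →
        c ∈ (Sum.inl '' Set.Iio k ∪ Set.range Sum.inr : Set (ℕ ⊕ Fin m)) := by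
      rintro (c | c) hc
      · exact Or.inl ⟨c, hz c hc, rfl⟩
      · exact Or.inr ⟨c, rfl⟩
    exact ⟨a, aux a (Sym2.mem_mk_left a b), b, aux b (Sym2.mem_mk_right a b), rfl⟩
  let mkG : (m : ℕ) → (Fin n → Sym2 (ℕ ⊕ Fin m)) → MultigraphClass := fun m g =>
    if h : (∀ e, ¬ (g e).IsDiag) ∧ ∀ v, ∃ e, Sum.inr v ∈ g e then
      mk ⟨Fin m, Fin n, inferInstance, inferInstance, g, h.1, h.2⟩ else 1
  have hfin : (⋃ m ∈ Set.Iic (2 * n), mkG m ''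
      (Set.univ.pi fun _ : Fin n => {z : Sym2 (ℕ ⊕ Fin m) | ∀ i, Sum.inl i ∈ z → i < k})).Finite :=
    (Set.finite_Iic _).biUnion fun m _ => (Set.Finite.pi' fun _ => hS m).image _ |>.subset
      (Set.image_mono fun g hg e => hg e (Set.mem_univ e))
  refine hfin.subset ?_
  rintro ⟨G⟩ ⟨hn, hk⟩
  change G.edgeCount = n at hn
  change G.IsLabelledBy k at hk
  obtain ⟨τ⟩ : Nonempty (G.E ≃ Fin n) := ⟨Fintype.equivFinOfCardEq hn⟩
  have σ : G.V ≃ Fin (Fintype.card G.V) := Fintype.equivFin _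
  have hinj : Function.Injective (Sum.map id σ : ℕ ⊕ G.V → _) :=
    Sum.map_injective.2 ⟨Function.injective_id, σ.injective⟩
  let g : Fin n → Sym2 (ℕ ⊕ Fin (Fintype.card G.V)) :=
    fun e => (G.ends (τ.symm e)).map (Sum.map id σ)
  have h1 : ∀ e, ¬ (g e).IsDiag := by
    intro e
    have := G.loopless (τ.symm e)
    simp only [g]
    generalize G.ends (τ.symm e) = z at this
    induction z with | _ a b => simpa [hinj.eq_iff] using this
  have h2 : ∀ v, ∃ e, Sum.inr v ∈ g e := by
    intro v
    obtain ⟨e, he⟩ := G.covered (σ.symm v)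
    exact ⟨τ e, Sym2.mem_map.2 ⟨_, by simpa using he, by simp⟩⟩
  have h3 : ∀ e i, Sum.inl i ∈ g e → i < k := by
    intro e i hi
    obtain ⟨a | a, ha, hai⟩ := Sym2.mem_map.1 hi
    · obtain rfl : a = i := Sum.inl_injective hai
      exact hk _ _ ha
    · simp at hai
  refine Set.mem_iUnion₂.2 ⟨Fintype.card G.V, hn ▸ card_V_le G, g, fun e _ => h3 e, ?_⟩
  refine (dif_pos ⟨h1, h2⟩).trans ?_
  refine Quotient.sound (PLMultigraph.Iso.symm ⟨σ, τ, fun e => ?_⟩)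
  simp [g]

/-- The finite set of isomorphism classes of `k`-labelled multigraphs with `n` edges and no
unlabelled isolated nodes. -/
noncomputable def classes (n k : ℕ) : Finset MultigraphClass := (finite_classes n k).toFinset

theorem finite_factorizations (H : MultigraphClass) :
    {p : MultigraphClass × MultigraphClass | p.1 * p.2 = H}.Finite := by
  obtain ⟨k, hk⟩ := H.exists_isLabelledBy
  have hT : (⋃ n ∈ Set.Iic H.edgeCount,
      {A : MultigraphClass | A.edgeCount = n ∧ A.IsLabelledBy k}).Finite :=
    (Set.finite_Iic _).biUnion fun n _ => finite_classes n k
  refine (hT.prod hT).subset ?_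
  rintro ⟨A, B⟩ rfl
  have h1 := edgeCount_mul A B
  have h2 := isLabelledBy_mul.1 hk
  simp only [Set.mem_prod, Set.mem_iUnion, Set.mem_Iic]
  exact ⟨⟨_, by omega, rfl, h2.1⟩, ⟨_, by omega, rfl, h2.2⟩⟩

noncomputable instance : Finset.HasMulAntidiagonal MultigraphClass where
  mulAntidiagonal H := (finite_factorizations H).toFinset
  mem_mulAntidiagonal := by simp

end MultigraphClass

/-- The algebra of partially labelled multigraphs: real linear combinations of classes. -/
abbrev QuantumGraphs : Type 1 := MonoidAlgebra ℝ MultigraphClass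

/-! ## Formal series of partially labelled multigraphs -/

/-- Families of real coefficients `a_H`, indexed by the classes of partially labelled multigraphs,
written as formal sums `∑ a_H H`. -/
def FormalSeries : Type 1 := MultigraphClass → ℝ

namespace FormalSeries

noncomputable instance : AddCommGroup FormalSeries :=
  inferInstanceAs (AddCommGroup (MultigraphClass → ℝ))

noncomputable instance : Module ℝ FormalSeries :=
  inferInstanceAs (Module ℝ (MultigraphClass → ℝ))

/-- The topology of coefficientwise convergence. -/
instance : TopologicalSpace FormalSeries :=
  inferInstanceAs (TopologicalSpace (MultigraphClass → ℝ))

/-- The coefficient of `a` at `H`. -/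
def coeff (a : FormalSeries) (H : MultigraphClass) : ℝ := a H

theorem ext {a b : FormalSeries} (h : ∀ H, a.coeff H = b.coeff H) : a = b := funext h

open scoped Classical in
/-- The series `c H`. -/
noncomputable def monomial (H : MultigraphClass) (c : ℝ) : FormalSeries := Pi.single H c

noncomputable instance : One FormalSeries := ⟨monomial 1 1⟩

/-- The Cauchy product: `(a b)_H` is the sum of `a_{H₁} b_{H₂}` over all `H₁ H₂ = H`. -/
noncomputable instance : Mul FormalSeries :=
  ⟨fun a b H => ∑ p ∈ Finset.HasMulAntidiagonal.mulAntidiagonal H, a p.1 * b p.2⟩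

@[simp] theorem coeff_add (a b : FormalSeries) (H) : (a + b).coeff H = a.coeff H + b.coeff H := rfl

@[simp] theorem coeff_zero (H) : (0 : FormalSeries).coeff H = 0 := rfl

@[simp] theorem coeff_smul (c : ℝ) (a : FormalSeries) (H) : (c • a).coeff H = c * a.coeff H := rfl

theorem coeff_mul (a b : FormalSeries) (H) :
    (a * b).coeff H = ∑ p ∈ Finset.HasMulAntidiagonal.mulAntidiagonal H, a.coeff p.1 * b.coeff p.2 := rfl

open scoped Classical in
theorem coeff_monomial (G : MultigraphClass) (c : ℝ) (H) :
    (monomial G c).coeff H = if H = G then c else 0 := by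
  simp only [coeff, monomial, Pi.single_apply]

protected theorem mul_comm' (a b : FormalSeries) : a * b = b * a := by
  refine ext fun H => ?_
  rw [coeff_mul, coeff_mul]
  refine Finset.sum_nbij' Prod.swap Prod.swap ?_ ?_ ?_ ?_ ?_
  · rintro ⟨A, B⟩ h
    simpa [mul_comm] using h
  · rintro ⟨A, B⟩ h
    simpa [mul_comm] using h
  · simp
  · simp
  · rintro ⟨A, B⟩ _
    exact mul_comm _ _

protected theorem one_mul' (a : FormalSeries) : 1 * a = a := by
  classical
  refine ext fun H => ?_
  rw [coeff_mul, Finset.sum_eq_single (1, H)]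
  · change (monomial 1 1).coeff 1 * a.coeff H = a.coeff H
    simp [coeff_monomial]
  · rintro ⟨A, B⟩ h hne
    change (monomial 1 1).coeff A * a.coeff B = 0
    rw [coeff_monomial, if_neg, zero_mul]
    rintro rfl
    apply hne
    simpa using h
  · intro h
    simp at h

protected theorem mul_assoc' (a b c : FormalSeries) : a * b * c = a * (b * c) := by
  classical
  refine ext fun H => ?_
  simp only [coeff_mul, Finset.sum_mul, Finset.mul_sum, Finset.sum_sigma']
  apply Finset.sum_nbij' (fun ⟨⟨_i, j⟩, ⟨k, l⟩⟩ ↦ ⟨(k, l * j), (l, j)⟩)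
    (fun ⟨⟨i, _j⟩, ⟨k, l⟩⟩ ↦ ⟨(i * k, l), (i, k)⟩)
  · rintro ⟨⟨i, j⟩, ⟨k, l⟩⟩ h
    simp only [Finset.mem_sigma, Finset.HasMulAntidiagonal.mem_mulAntidiagonal] at h ⊢
    exact ⟨by rw [← mul_assoc, h.2, h.1], trivial⟩
  · rintro ⟨⟨i, j⟩, ⟨k, l⟩⟩ h
    simp only [Finset.mem_sigma, Finset.HasMulAntidiagonal.mem_mulAntidiagonal] at h ⊢
    exact ⟨by rw [mul_assoc, h.2, h.1], trivial⟩
  · rintro ⟨⟨i, j⟩, ⟨k, l⟩⟩ h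
    simp only [Finset.mem_sigma, Finset.HasMulAntidiagonal.mem_mulAntidiagonal] at h ⊢
    simp [h.2]
  · rintro ⟨⟨i, j⟩, ⟨k, l⟩⟩ h
    simp only [Finset.mem_sigma, Finset.HasMulAntidiagonal.mem_mulAntidiagonal] at h ⊢
    simp [h.2]
  · rintro ⟨⟨i, j⟩, ⟨k, l⟩⟩ _
    exact mul_assoc _ _ _

protected theorem add_mul' (a b c : FormalSeries) : (a + b) * c = a * c + b * c := by
  refine ext fun H => ?_
  simp only [coeff_add, coeff_mul, add_mul, Finset.sum_add_distrib]

protected theorem smul_mul' (r : ℝ) (a b : FormalSeries) : r • a * b = r • (a * b) := by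
  refine ext fun H => ?_
  simp only [coeff_smul, coeff_mul, Finset.mul_sum, mul_assoc]

noncomputable instance : CommRing FormalSeries where
  __ := (inferInstance : AddCommGroup FormalSeries)
  __ := (inferInstance : One FormalSeries)
  __ := (inferInstance : Mul FormalSeries)
  mul_assoc := FormalSeries.mul_assoc'
  mul_comm := FormalSeries.mul_comm'
  one_mul := FormalSeries.one_mul'
  mul_one a := by rw [FormalSeries.mul_comm', FormalSeries.one_mul']
  left_distrib a b c := by
    rw [FormalSeries.mul_comm', FormalSeries.add_mul', FormalSeries.mul_comm' b,
      FormalSeries.mul_comm' c]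
  right_distrib := FormalSeries.add_mul'
  zero_mul a := by
    refine ext fun H => ?_
    simp [coeff_mul]
  mul_zero a := by
    refine ext fun H => ?_
    simp [coeff_mul]

noncomputable instance : Algebra ℝ FormalSeries :=
  Algebra.ofModule FormalSeries.smul_mul' (fun r a b => by
    rw [mul_comm, FormalSeries.smul_mul', mul_comm])

theorem algebraMap_eq (r : ℝ) : algebraMap ℝ FormalSeries r = monomial 1 r := by
  classical
  rw [Algebra.algebraMap_eq_smul_one]
  refine ext fun H => ?_
  change (r • monomial 1 1).coeff H = _
  simp [coeff_monomial]

theorem monomial_mul (A B : MultigraphClass) :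
    monomial A 1 * monomial B 1 = monomial (A * B) 1 := by
  classical
  refine ext fun H => ?_
  rw [coeff_mul, coeff_monomial]
  split_ifs with h
  · rw [Finset.sum_eq_single (A, B)]
    · simp [coeff_monomial]
    · rintro ⟨C, D⟩ _ hne
      simp only [coeff_monomial, mul_ite, mul_one, mul_zero]
      split_ifs with h1 h2
      · exact absurd (by rw [h1, h2]) hne
      all_goals rfl
    · simp [h]
  · refine Finset.sum_eq_zero ?_
    rintro ⟨C, D⟩ hCD
    simp only [coeff_monomial, mul_ite, mul_one, mul_zero]
    split_ifs with h1 h2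
    · subst h1 h2
      rw [Finset.HasMulAntidiagonal.mem_mulAntidiagonal] at hCD
      exact absurd hCD.symm h
    all_goals rfl

/-- The formal series of `k`-labelled multigraphs: the coefficients of all classes that are not
`k`-labelled vanish. So this is the product over `n` of the spaces of families indexed by
`MultigraphClass.classes n k`. -/
noncomputable def labelled (k : ℕ) : Subalgebra ℝ FormalSeries where
  carrier := {a | ∀ H, a.coeff H ≠ 0 → H.IsLabelledBy k}
  add_mem' := by
    intro a b ha hb H h
    rcases ne_or_eq (a.coeff H) 0 with h' | h'
    · exact ha H h'
    · exact hb H fun h'' => h (by simp [h', h''])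
  mul_mem' := by
    intro a b ha hb H h
    rw [coeff_mul] at h
    obtain ⟨⟨A, B⟩, hp, hne⟩ := Finset.exists_ne_zero_of_sum_ne_zero h
    rw [Finset.HasMulAntidiagonal.mem_mulAntidiagonal] at hp
    rw [← hp]
    exact MultigraphClass.isLabelledBy_mul.2
      ⟨ha _ (left_ne_zero_of_mul hne), hb _ (right_ne_zero_of_mul hne)⟩
  algebraMap_mem' := by
    classical
    intro r H h
    rw [algebraMap_eq, coeff_monomial] at h
    obtain rfl : H = 1 := by
      by_contra hH
      simp [hH] at h
    exact MultigraphClass.isLabelledBy_one k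

theorem labelled_mono {k l : ℕ} (h : k ≤ l) : labelled k ≤ labelled l :=
  fun _ ha H hH => (ha H hH).mono h

theorem monomial_mem_labelled {H : MultigraphClass} {k : ℕ} (hH : H.IsLabelledBy k) (c : ℝ) :
    monomial H c ∈ labelled k := by
  classical
  intro G hG
  rw [coeff_monomial] at hG
  obtain rfl : G = H := by
    by_contra h
    simp [h] at hG
  exact hH

/-- The sum of `|a_H|` over all `H` with `n` edges. -/
noncomputable def levelNorm (a : FormalSeries) (n : ℕ) : ℝ≥0∞ :=
  ∑' H : {H : MultigraphClass // H.edgeCount = n}, ‖a.coeff H.1‖ₑ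

/-- The radius of convergence: the inverse of `limsup (∑_{H with n edges} |a_H|) ^ (1 / n)`. -/
noncomputable def radius (a : FormalSeries) : ℝ≥0∞ :=
  (limsup (fun n : ℕ => a.levelNorm n ^ (1 / (n : ℝ))) atTop)⁻¹

/-- The sum of `|a_H| r ^ |E(H)|` over all `H`. -/
noncomputable def weightedNorm (r : ℝ≥0∞) (a : FormalSeries) : ℝ≥0∞ :=
  ∑' H : MultigraphClass, ‖a.coeff H‖ₑ * r ^ H.edgeCount

theorem weightedNorm_eq (r : ℝ≥0∞) (a : FormalSeries) :
    a.weightedNorm r = ∑' n : ℕ, a.levelNorm n * r ^ n := by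
  rw [weightedNorm, ← (Equiv.sigmaFiberEquiv MultigraphClass.edgeCount).tsum_eq,
    ENNReal.tsum_sigma']
  refine tsum_congr fun n => ?_
  rw [levelNorm, ← ENNReal.tsum_mul_right]
  refine tsum_congr fun H => ?_
  simp only [Equiv.sigmaFiberEquiv, Equiv.coe_fn_mk]
  rw [H.2]

theorem levelNorm_lt_top {k : ℕ} {a : FormalSeries} (ha : a ∈ labelled k) (n : ℕ) :
    a.levelNorm n < ∞ := by
  classical
  have h := ENNReal.sum_lt_top (s := MultigraphClass.classes n k)
    (f := fun H => ‖a.coeff H‖ₑ) |>.2 fun H _ => enorm_lt_top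
  refine lt_of_le_of_lt ?_ h
  rw [levelNorm]
  have e : ∑' H : {H : MultigraphClass // H.edgeCount = n}, ‖a.coeff H.1‖ₑ =
      ∑' H : MultigraphClass, {H : MultigraphClass | H.edgeCount = n}.indicator
        (fun H => ‖a.coeff H‖ₑ) H :=
    tsum_subtype {H : MultigraphClass | H.edgeCount = n} (fun H => ‖a.coeff H‖ₑ)
  rw [e, tsum_eq_sum (s := MultigraphClass.classes n k)]
  · exact Finset.sum_le_sum fun H _ => Set.indicator_le_self _ _ _
  · intro H hH
    by_cases hn : H.edgeCount = n
    · have : a.coeff H = 0 := by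
        by_contra hne
        exact hH ((MultigraphClass.finite_classes n k).mem_toFinset.2 ⟨hn, ha H hne⟩)
      simp [this]
    · simp [hn]

theorem weightedNorm_add (r : ℝ≥0∞) (a b : FormalSeries) :
    (a + b).weightedNorm r ≤ a.weightedNorm r + b.weightedNorm r := by
  rw [weightedNorm, weightedNorm, weightedNorm, ← ENNReal.tsum_add]
  refine ENNReal.tsum_le_tsum fun H => ?_
  rw [← add_mul, coeff_add]
  gcongr
  exact enorm_add_le _ _

theorem weightedNorm_mul (r : ℝ≥0∞) (a b : FormalSeries) :
    (a * b).weightedNorm r ≤ a.weightedNorm r * b.weightedNorm r := by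
  rw [weightedNorm, weightedNorm, weightedNorm, ← ENNReal.tsum_mul_right]
  simp_rw [← ENNReal.tsum_mul_left]
  rw [← ENNReal.tsum_prod (f := fun A B : MultigraphClass =>
    ‖a.coeff A‖ₑ * r ^ A.edgeCount * (‖b.coeff B‖ₑ * r ^ B.edgeCount)),
    ← Finset.HasMulAntidiagonal.sigmaMulAntidiagonalEquivProd.tsum_eq, ENNReal.tsum_sigma']
  refine ENNReal.tsum_le_tsum fun H => ?_
  rw [tsum_fintype, coeff_mul]
  refine (mul_le_mul_left (enorm_sum_le _ _) _).trans ?_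
  rw [Finset.sum_mul, ← Finset.sum_coe_sort]
  refine Finset.sum_le_sum ?_
  rintro ⟨⟨A, B⟩, hp⟩ _
  rw [Finset.HasMulAntidiagonal.mem_mulAntidiagonal] at hp
  simp only [Finset.HasMulAntidiagonal.sigmaMulAntidiagonalEquivProd, Equiv.coe_fn_mk] at hp ⊢
  rw [← hp, MultigraphClass.edgeCount_mul, pow_add, enorm_mul]
  exact le_of_eq (by ring)

theorem weightedNorm_monomial (r : ℝ≥0∞) (H : MultigraphClass) (c : ℝ) :
    (monomial H c).weightedNorm r = ‖c‖ₑ * r ^ H.edgeCount := by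
  classical
  rw [weightedNorm, tsum_eq_single H]
  · simp [coeff_monomial]
  · intro G hG
    simp [coeff_monomial, hG]

theorem weightedNorm_lt_top {k : ℕ} {a : FormalSeries} (ha : a ∈ labelled k) {r : ℝ≥0∞}
    (hr : r < a.radius) : a.weightedNorm r < ∞ := by
  obtain ⟨t, hrt, hta⟩ := exists_between hr
  have ht0 : t ≠ 0 := (bot_le.trans_lt hrt).ne'
  have htt : t ≠ ∞ := (hta.trans_le le_top).ne
  have hlim : limsup (fun n : ℕ => a.levelNorm n ^ (1 / (n : ℝ))) atTop < t⁻¹ := by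
    rw [← ENNReal.inv_lt_inv, inv_inv]
    exact hta
  obtain ⟨N, hN⟩ := eventually_atTop.1 (eventually_lt_of_limsup_lt hlim)
  have hle : ∀ n, N + 1 ≤ n → a.levelNorm n * r ^ n ≤ (t⁻¹ * r) ^ n := by
    intro n hn
    have h1 := (hN n (by omega)).le
    have hn0 : (n : ℝ) ≠ 0 := by
      have : n ≠ 0 := by omega
      exact_mod_cast this
    have h2 : a.levelNorm n ≤ t⁻¹ ^ n := by
      calc a.levelNorm n = (a.levelNorm n ^ (1 / (n : ℝ))) ^ n := by
            rw [← ENNReal.rpow_natCast, ← ENNReal.rpow_mul, one_div, inv_mul_cancel₀ hn0,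
              ENNReal.rpow_one]
        _ ≤ t⁻¹ ^ n := by gcongr
    rw [mul_pow]
    gcongr
  rw [weightedNorm_eq, ← Summable.sum_add_tsum_nat_add' (k := N + 1)
    (f := fun n => a.levelNorm n * r ^ n) ENNReal.summable]
  refine ENNReal.add_lt_top.2 ⟨ENNReal.sum_lt_top.2 fun n _ => ?_, ?_⟩
  · exact ENNReal.mul_lt_top (levelNorm_lt_top ha n)
      (ENNReal.pow_lt_top (hr.trans_le le_top))
  · have hq : t⁻¹ * r < 1 := by
      rw [mul_comm, ← div_eq_mul_inv]
      exact ENNReal.div_lt_of_lt_mul (by rwa [one_mul])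
    calc ∑' n, a.levelNorm (n + (N + 1)) * r ^ (n + (N + 1))
        ≤ ∑' n : ℕ, (t⁻¹ * r) ^ n := by
          refine ENNReal.tsum_le_tsum fun n => (hle _ (by omega)).trans ?_
          exact pow_le_pow_right_of_le_one' hq.le (by omega)
      _ = (1 - t⁻¹ * r)⁻¹ := ENNReal.tsum_geometric _
      _ < ∞ := by
          rw [ENNReal.inv_lt_top]
          exact tsub_pos_of_lt hq

theorem le_radius {a : FormalSeries} {r : ℝ≥0∞} (h : a.weightedNorm r < ∞) : r ≤ a.radius := by
  rcases eq_or_ne r 0 with rfl | hr0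
  · exact bot_le
  have main : ∀ t : ℝ≥0∞, t ≠ 0 → t ≠ ∞ → t ≤ r → t ≤ a.radius := by
    intro t ht0 htt htr
    have hC : a.weightedNorm t < ∞ := by
      refine lt_of_le_of_lt (ENNReal.tsum_le_tsum fun H => ?_) h
      gcongr
    set C := max (a.weightedNorm t) 1 with hCdef
    have hC0 : C ≠ 0 := (zero_lt_one.trans_le (le_max_right _ _)).ne'
    have hCt : C ≠ ∞ := (max_lt hC ENNReal.one_lt_top).ne
    have hbound : ∀ n : ℕ, n ≠ 0 → a.levelNorm n ^ (1 / (n : ℝ)) ≤ C ^ (1 / (n : ℝ)) * t⁻¹ := by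
      intro n hn
      have hn0 : (n : ℝ) ≠ 0 := by exact_mod_cast hn
      have h1 : a.levelNorm n * t ^ n ≤ C := by
        refine le_trans ?_ (le_max_left _ _)
        rw [weightedNorm_eq]
        exact ENNReal.le_tsum n
      have h2 : a.levelNorm n ≤ C * t⁻¹ ^ n := by
        rw [← ENNReal.inv_pow, ← div_eq_mul_inv]
        exact (ENNReal.le_div_iff_mul_le (Or.inl (pow_ne_zero _ ht0))
          (Or.inl (ENNReal.pow_ne_top htt))).2 h1
      calc a.levelNorm n ^ (1 / (n : ℝ)) ≤ (C * t⁻¹ ^ n) ^ (1 / (n : ℝ)) := by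
            gcongr
        _ = C ^ (1 / (n : ℝ)) * t⁻¹ := by
            rw [ENNReal.mul_rpow_of_nonneg _ _ (by positivity), ← ENNReal.rpow_natCast,
              ← ENNReal.rpow_mul, one_div, mul_inv_cancel₀ hn0, ENNReal.rpow_one]
    have hlim : Tendsto (fun n : ℕ => C ^ (1 / (n : ℝ)) * t⁻¹) atTop (𝓝 t⁻¹) := by
      have h1 : Tendsto (fun n : ℕ => C ^ (1 / (n : ℝ))) atTop (𝓝 1) := by
        lift C to NNReal using hCt with c
        have hc0 : c ≠ 0 := by simpa using hC0
        have hc : Tendsto (fun n : ℕ => c ^ (1 / (n : ℝ))) atTop (𝓝 (c ^ (0 : ℝ))) :=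
          ((NNReal.continuousAt_rpow (x := c) (y := 0) (Or.inl hc0)).tendsto.comp
            (tendsto_const_nhds.prodMk_nhds tendsto_one_div_atTop_nhds_zero_nat))
        rw [NNReal.rpow_zero] at hc
        have := ENNReal.tendsto_coe.2 hc
        refine this.congr fun n => ?_
        rw [ENNReal.coe_rpow_of_ne_zero hc0]
      simpa using ENNReal.Tendsto.mul_const h1 (Or.inl one_ne_zero)
    rw [radius, ENNReal.le_inv_iff_le_inv]
    calc limsup (fun n : ℕ => a.levelNorm n ^ (1 / (n : ℝ))) atTop
        ≤ limsup (fun n : ℕ => C ^ (1 / (n : ℝ)) * t⁻¹) atTop := by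
          refine limsup_le_limsup ?_
          filter_upwards [eventually_ne_atTop 0] with n hn
          exact hbound n hn
      _ = t⁻¹ := hlim.limsup_eq
  refine le_of_forall_lt fun t ht => ?_
  obtain ⟨u, htu, hur⟩ := exists_between ht
  exact htu.trans_le (main u (bot_le.trans_lt htu).ne' (hur.trans_le le_top).ne hur.le)

theorem radius_add {k : ℕ} {a b : FormalSeries} (ha : a ∈ labelled k) (hb : b ∈ labelled k) :
    min a.radius b.radius ≤ (a + b).radius := by
  refine le_of_forall_lt fun t ht => ?_
  obtain ⟨u, htu, hu⟩ := exists_between ht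
  refine htu.trans_le (le_radius ((weightedNorm_add u a b).trans_lt ?_))
  exact ENNReal.add_lt_top.2 ⟨weightedNorm_lt_top ha (hu.trans_le (min_le_left _ _)),
    weightedNorm_lt_top hb (hu.trans_le (min_le_right _ _))⟩

theorem radius_mul {k : ℕ} {a b : FormalSeries} (ha : a ∈ labelled k) (hb : b ∈ labelled k) :
    min a.radius b.radius ≤ (a * b).radius := by
  refine le_of_forall_lt fun t ht => ?_
  obtain ⟨u, htu, hu⟩ := exists_between ht
  refine htu.trans_le (le_radius ((weightedNorm_mul u a b).trans_lt ?_))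
  exact ENNReal.mul_lt_top (weightedNorm_lt_top ha (hu.trans_le (min_le_left _ _)))
    (weightedNorm_lt_top hb (hu.trans_le (min_le_right _ _)))

theorem radius_monomial (H : MultigraphClass) (c : ℝ) : (monomial H c).radius = ∞ := by
  refine top_le_iff.1 (le_of_forall_lt fun t ht => ?_)
  obtain ⟨u, htu, hu⟩ := exists_between ht
  refine htu.trans_le (le_radius ?_)
  rw [weightedNorm_monomial]
  exact ENNReal.mul_lt_top enorm_lt_top (ENNReal.pow_lt_top hu)

/-- The radius of convergence exceeds `R`; for `R = ∞` this means that it is infinite. -/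
def RadiusExceeds (R : ℝ≥0∞) (a : FormalSeries) : Prop := R < a.radius ∨ a.radius = ∞

theorem RadiusExceeds.of_min_le {R : ℝ≥0∞} {a b c : FormalSeries} (ha : a.RadiusExceeds R)
    (hb : b.RadiusExceeds R) (h : min a.radius b.radius ≤ c.radius) : c.RadiusExceeds R := by
  rcases ha with ha | ha <;> rcases hb with hb | hb
  · exact Or.inl ((lt_min ha hb).trans_le h)
  · exact Or.inl (ha.trans_le (by simpa [hb] using h))
  · exact Or.inl (hb.trans_le (by simpa [ha] using h))
  · exact Or.inr (top_le_iff.1 (by simpa [ha, hb] using h))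

/-- The algebra of formal series of `k`-labelled multigraphs, for some `k`, with radius of
convergence greater than `R`. -/
noncomputable def convergent (R : ℝ≥0∞) : Subalgebra ℝ FormalSeries where
  carrier := {a | (∃ k, a ∈ labelled k) ∧ a.RadiusExceeds R}
  add_mem' := by
    rintro a b ⟨⟨k, ha⟩, hRa⟩ ⟨⟨l, hb⟩, hRb⟩
    have ha' := labelled_mono (le_max_left k l) ha
    have hb' := labelled_mono (le_max_right k l) hb
    exact ⟨⟨_, add_mem ha' hb'⟩, hRa.of_min_le hRb (radius_add ha' hb')⟩
  mul_mem' := by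
    rintro a b ⟨⟨k, ha⟩, hRa⟩ ⟨⟨l, hb⟩, hRb⟩
    have ha' := labelled_mono (le_max_left k l) ha
    have hb' := labelled_mono (le_max_right k l) hb
    exact ⟨⟨_, mul_mem ha' hb'⟩, hRa.of_min_le hRb (radius_mul ha' hb')⟩
  algebraMap_mem' := fun r => ⟨⟨0, Subalgebra.algebraMap_mem _ r⟩, Or.inr (by
    rw [algebraMap_eq, radius_monomial])⟩

/-- The inclusion of finite linear combinations into the series with radius greater than `R`. -/
noncomputable def ofQuantumGraphs (R : ℝ≥0∞) : QuantumGraphs →ₐ[ℝ] convergent R :=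
  MonoidAlgebra.lift ℝ (convergent R) MultigraphClass
    { toFun := fun H => ⟨monomial H 1,
        H.exists_isLabelledBy.imp fun _ hk => monomial_mem_labelled hk 1,
        Or.inr (radius_monomial H 1)⟩
      map_one' := rfl
      map_mul' := fun A B => Subtype.ext (monomial_mul A B).symm }

end FormalSeries

/-! ## Kernels and homomorphism densities -/

/-- A bounded symmetric measurable function on the unit square. -/
structure Kernel where
  toFun : unitInterval → unitInterval → ℝ
  symm : ∀ u v, toFun u v = toFun v u
  measurable : Measurable (Function.uncurry toFun)
  bounded : ∃ C, ∀ u v, |toFun u v| ≤ C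

/-- The kernels with values in the interval `[-s, s]`. -/
def KernelBall (s : ℝ) : Type := {f : Kernel // ∀ u v, f.toFun u v ∈ Set.Icc (-s) s}

/-- The value `f (p a, p b)` at an unordered pair `{a, b}`. -/
def Kernel.onPair (f : Kernel) {ι : Type} (p : ι → unitInterval) : Sym2 ι → ℝ :=
  Sym2.lift ⟨fun a b => f.toFun (p a) (p b), fun _ _ => f.symm _ _⟩

theorem Kernel.onPair_map (f : Kernel) {ι κ : Type} (p : κ → unitInterval) (q : ι → κ)
    (z : Sym2 ι) : f.onPair p (z.map q) = f.onPair (p ∘ q) z := by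
  induction z with | _ a b => rfl

/-- The homomorphism density of a multigraph whose node with label `i` is placed at `x i`:
the integral, over all positions of the unlabelled nodes, of the product over the edges of
the values of the kernel at the positions of the end points. -/
noncomputable def PLMultigraph.density (x : ℕ → unitInterval) (H : PLMultigraph) (f : Kernel) : ℝ :=
  ∫ y : H.V → unitInterval, ∏ e : H.E, f.onPair (Sum.elim x y) (H.ends e)

theorem PLMultigraph.density_congr (x : ℕ → unitInterval) {G H : PLMultigraph} (h : G.Iso H) :
    G.density x = H.density x := by
  obtain ⟨σ, τ, h⟩ := h
  funext f
  have hm := volume_preserving_arrowCongr' σ (MeasurableEquiv.refl unitInterval)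
    (MeasurePreserving.id volume)
  rw [density, density, ← hm.integral_comp']
  refine integral_congr_ae (Eventually.of_forall fun y => ?_)
  refine Fintype.prod_equiv τ _ _ fun e => ?_
  rw [h, Kernel.onPair_map]
  congr 1
  funext v
  rcases v with i | v
  · rfl
  · simp [MeasurableEquiv.arrowCongr', Equiv.arrowCongr']

theorem PLMultigraph.density_glue (x : ℕ → unitInterval) (G H : PLMultigraph) (f : Kernel) :
    (G.glue H).density x f = G.density x f * H.density x f := by
  have hm := volume_measurePreserving_sumPiEquivProdPi_symm
    (fun _ : G.V ⊕ H.V => unitInterval)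
  rw [density, density, density, ← integral_prod_mul]
  change ∫ y : G.V ⊕ H.V → unitInterval, ∏ e : G.E ⊕ H.E,
    f.onPair (Sum.elim x y) ((G.glue H).ends e) = _
  rw [← hm.integral_comp']
  refine integral_congr_ae (Eventually.of_forall fun y => ?_)
  change ∏ e : G.E ⊕ H.E, _ = _
  rw [Fintype.prod_sum_type]
  congr 1
  · refine Finset.prod_congr rfl fun e _ => ?_
    simp only [glue, Sum.elim_inl, Kernel.onPair_map]
    congr 1
    funext v
    rcases v with i | v <;> rfl
  · refine Finset.prod_congr rfl fun e _ => ?_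
    simp only [glue, Sum.elim_inr, Kernel.onPair_map]
    congr 1
    funext v
    rcases v with i | v <;> rfl

theorem PLMultigraph.density_empty (x : ℕ → unitInterval) (f : Kernel) :
    empty.density x f = 1 := by
  have : ∀ y : empty.V → unitInterval,
      ∏ e : empty.E, f.onPair (Sum.elim x y) (empty.ends e) = 1 := fun y =>
    Fintype.prod_empty (ι := Empty) _
  simp [density, this]

namespace MultigraphClass

/-- The homomorphism density of an isomorphism class. -/
noncomputable def density (x : ℕ → unitInterval) : MultigraphClass → Kernel → ℝ :=
  Quotient.lift (PLMultigraph.density x) fun _ _ h => PLMultigraph.density_congr x h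

/-- The algebra map from quantum graphs to functions of kernels with values in `[-s, s]` that
sends a multigraph to its homomorphism density. -/
noncomputable def alpha (x : ℕ → unitInterval) (s : ℝ) :
    QuantumGraphs →ₐ[ℝ] (KernelBall s → ℝ) :=
  MonoidAlgebra.lift ℝ (KernelBall s → ℝ) MultigraphClass
    { toFun := fun H f => H.density x f.1
      map_one' := funext fun f => PLMultigraph.density_empty x f.1
      map_mul' := by
        rintro ⟨G⟩ ⟨H⟩
        exact funext fun f => PLMultigraph.density_glue x G H f.1 }

end MultigraphClass

/-!
The extension of `alpha` is summation: `FormalSeries.densityHom` maps `∑ a_H H` to the function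
`∑ a_H t_x(H, -)`. A kernel with values in `[-s, s]` satisfies `|t_x(H, f)| ≤ s ^ n` for a multigraph
`H` with `n` edges (`MultigraphClass.abs_density_le`), so for a series with radius of convergence
greater than `s` the sum converges absolutely and uniformly in `f`; products may be rearranged, since
`t_x(-, f)` is multiplicative. If moreover `∑ |a_H| r ^ n ≤ C` with `r > s`, then the `n`-th term of the
sum is bounded by `C (s / r) ^ n`. So on this set of series the partial sums, which depend only on
finitely many coefficients, converge uniformly, and their limit is continuous
(`FormalSeries.continuousOn_densityHom`).

If `x i = x j` for some `i ≠ j`, then the edges from the labels `i` and `j` to an unlabelled node have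
the same densities. Conversely, let `x` be injective, and suppose that a series is mapped to zero.
Evaluating at `t f` for `t ∈ (0, 1]` and comparing the coefficients of `t ^ n` shows that every
homogeneous part is mapped to zero (`FormalSeries.levelDensity_eq_zero`). This leaves the linear
independence of the densities of finitely many multigraphs with the same number of edges
(`MultigraphClass.eq_zero_of_sum_density_eq_zero`). Take step kernels, for a partition into
sufficiently many sets of positive measure, with the points `x i` for `i < k` as additional steps of
measure zero; this is where injectivity is used. In such kernels the density of `H` is a polynomial
in the values of the kernel, a sum over all maps `φ` from the unlabelled nodes to the steps, where `φ`
contributes a positive multiple of the monomial with exponent the multiset of the images of the edges.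
Among the multigraphs in a linear relation choose one, `H₀`, with the most unlabelled nodes, and
consider the monomial of an injective `φ`. As no unlabelled node is isolated, another multigraph with
this monomial would have more unlabelled nodes or be isomorphic to `H₀`
(`PLMultigraph.iso_of_edgeExponent_eq`). Hence the coefficient of `H₀` in the relation is zero.
-/

/-! ### Step kernels -/

/-- The kernel whose value at `(u, v)` is the weight `B` of the unordered pair of colours of `u`
and `v`, for a measurable colouring `c` of the unit interval by finitely many colours. -/
noncomputable def Kernel.ofColouring {κ : Type} [Countable κ] (c : unitInterval → κ)
    (hc : ∀ S : Set κ, MeasurableSet (c ⁻¹' S)) (hfin : (Set.range c).Finite)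
    (B : Sym2 κ → ℝ) : Kernel where
  toFun u v := B s(c u, c v)
  symm u v := by rw [Sym2.eq_swap]
  measurable := by
    let _ : MeasurableSpace κ := ⊤
    have hcm : Measurable c := fun S _ => hc S
    have hB : Measurable fun p : κ × κ => B s(p.1, p.2) := measurable_of_countable _
    exact hB.comp (hcm.prodMap hcm)
  bounded := by
    obtain ⟨C, hC⟩ := ((hfin.image2 (fun a b => |B s(a, b)|) hfin)).bddAbove
    exact ⟨C, fun u v => hC ⟨_, ⟨u, rfl⟩, _, ⟨v, rfl⟩, rfl⟩⟩

theorem Kernel.onPair_ofColouring {κ ι : Type} [Countable κ] (c : unitInterval → κ)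
    (hc : ∀ S : Set κ, MeasurableSet (c ⁻¹' S)) (hfin : (Set.range c).Finite)
    (B : Sym2 κ → ℝ) (p : ι → unitInterval) (z : Sym2 ι) :
    (Kernel.ofColouring c hc hfin B).onPair p z = B (z.map (c ∘ p)) := by
  induction z with | _ a b => rfl

/-- A measurable partition of the unit interval into finitely many sets of positive measure. -/
theorem unitInterval.exists_measurable_partition (m : ℕ) :
    ∃ d : unitInterval → Fin (m + 1), Measurable d ∧ ∀ j, 0 < volume.real (d ⁻¹' {j}) := by
  refine ⟨fun u => Fin.ofNat (m + 1) ⌊((m : ℝ) + 1) * u⌋₊, ?_, fun j => ?_⟩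
  · exact (measurable_of_countable (Fin.ofNat (m + 1))).comp
      (Nat.measurable_floor.comp (measurable_subtype_coe.const_mul _))
  · have hj : (j : ℝ) + 1 ≤ m + 1 := by exact_mod_cast j.2
    have hm : (0 : ℝ) < m + 1 := by positivity
    let a : unitInterval := ⟨(j : ℝ) / (m + 1), by positivity, by
      rw [div_le_one hm]
      linarith⟩
    let b : unitInterval := ⟨((j : ℝ) + 1) / (m + 1), by positivity, by rwa [div_le_one hm]⟩
    have hsub : Set.Ico a b ⊆
        (fun u : unitInterval => Fin.ofNat (m + 1) ⌊((m : ℝ) + 1) * u⌋₊) ⁻¹' {j} := by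
      rintro u ⟨h1, h2⟩
      have h1' : (j : ℝ) ≤ (m + 1) * u := (div_le_iff₀' hm).1 h1
      have h2' : ((m : ℝ) + 1) * u < j + 1 := (lt_div_iff₀' hm).1 h2
      have hf : ⌊((m : ℝ) + 1) * u⌋₊ = j := by
        rw [Nat.floor_eq_iff ((Nat.cast_nonneg _).trans h1')]
        exact ⟨h1', h2'⟩
      simp [hf]
    have hab : 0 < volume (Set.Ico a b) := by
      rw [unitInterval.volume_Ico, ENNReal.ofReal_pos, sub_pos]
      exact div_lt_div_of_pos_right (lt_add_one _) hm
    exact ENNReal.toReal_pos (hab.trans_le (measure_mono hsub)).ne' (measure_ne_top _ _)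

/-- Distinct points can be given distinct private colours, at the cost of a null set. -/
theorem unitInterval.exists_colouring {x : ℕ → unitInterval} (hx : Function.Injective x) (k : ℕ)
    {m : ℕ} {d : unitInterval → Fin m} (hd : Measurable d) :
    ∃ c : unitInterval → ℕ ⊕ Fin m, (∀ S : Set (ℕ ⊕ Fin m), MeasurableSet (c ⁻¹' S)) ∧
      (Set.range c).Finite ∧ (∀ i < k, c (x i) = Sum.inl i) ∧ ∀ᵐ u, c u = Sum.inr (d u) := by
  classical
  let c : unitInterval → ℕ ⊕ Fin m := fun u =>
    if h : ∃ i < k, x i = u then Sum.inl h.choose else Sum.inr (d u)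
  have hc : ∀ i < k, c (x i) = Sum.inl i := by
    intro i hi
    have h : ∃ j < k, x j = x i := ⟨i, hi, rfl⟩
    change dite _ _ _ = _
    rw [dif_pos h]
    exact congrArg _ (hx h.choose_spec.2)
  have hne : {u | Sum.inr (d u) ≠ c u} ⊆ x '' Set.Iio k := by
    intro u hu
    by_contra h
    have h' : ¬ ∃ i < k, x i = u := by
      rintro ⟨i, hi, rfl⟩
      exact h ⟨i, hi, rfl⟩
    exact hu (by simp only [c, dif_neg h'])
  have hfin := ((Set.finite_Iio k).image x).subset hne
  refine ⟨c, ?_, ?_, hc, ?_⟩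
  · let _ : MeasurableSpace (ℕ ⊕ Fin m) := ⊤
    have h1 : Measurable fun u => (Sum.inr (d u) : ℕ ⊕ Fin m) :=
      (measurable_of_countable _).comp hd
    exact fun S => h1.measurable_of_countable_ne hfin.countable (MeasurableSpace.measurableSet_top)
  · refine (((Set.finite_Iio k).image Sum.inl).union
      (Set.finite_range (Sum.inr : Fin m → ℕ ⊕ Fin m))).subset ?_
    rintro _ ⟨u, rfl⟩
    by_cases h : ∃ i < k, x i = u
    · exact Or.inl ⟨h.choose, h.choose_spec.1, by simp only [c, dif_pos h]⟩
    · exact Or.inr ⟨d u, by simp only [c, dif_neg h]⟩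
  · have h0 : volume {u | Sum.inr (d u) ≠ c u} = 0 := hfin.measure_zero _
    filter_upwards [(ae_iff (p := fun u => Sum.inr (d u) = c u)).2 h0] with u hu
    exact hu.symm

/-! ### Densities in step kernels as polynomials -/

namespace PLMultigraph

/-- The multiset of the images of the edges of `G`, as exponent of a monomial, when the unlabelled
nodes are mapped by `φ` and the labelled ones are kept. -/
noncomputable def edgeExponent (G : PLMultigraph) {m : ℕ} (φ : G.V → Fin m) :
    Sym2 (ℕ ⊕ Fin m) →₀ ℕ :=
  ∑ e, Finsupp.single ((G.ends e).map (Sum.map id φ)) 1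

open scoped Classical in
/-- The density of `G` in a step kernel, as a polynomial in the values of the kernel: a sum over
all maps from the unlabelled nodes to the set of steps, where `p j` is the measure of step `j`. -/
noncomputable def densityPoly (G : PLMultigraph) {m : ℕ} (p : Fin m → ℝ) :
    MvPolynomial (Sym2 (ℕ ⊕ Fin m)) ℝ :=
  ∑ φ : G.V → Fin m, MvPolynomial.monomial (G.edgeExponent φ) (∏ v, p (φ v))

open scoped Classical in
theorem eval_densityPoly (G : PLMultigraph) {m : ℕ} (p : Fin m → ℝ) (B : Sym2 (ℕ ⊕ Fin m) → ℝ) :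
    MvPolynomial.eval B (G.densityPoly p) =
      ∑ φ : G.V → Fin m, (∏ v, p (φ v)) * ∏ e, B ((G.ends e).map (Sum.map id φ)) := by
  rw [densityPoly, map_sum]
  refine Finset.sum_congr rfl fun φ _ => ?_
  rw [MvPolynomial.eval_monomial, edgeExponent,
    ← Finsupp.prod_finsetSum_index (fun _ => pow_zero _) (fun _ _ _ => pow_add _ _ _)]
  congr 1
  refine Finset.prod_congr rfl fun e _ => ?_
  exact (Finsupp.prod_single_index (h := fun z j => B z ^ j) (pow_zero _)).trans (pow_one _)

theorem _root_.unitInterval.integral_comp_pi {V : Type} [Fintype V] [DecidableEq V]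
    {m : ℕ} {d : unitInterval → Fin m} (hd : Measurable d) (g : (V → Fin m) → ℝ) :
    ∫ y : V → unitInterval, g (fun v => d (y v)) =
      ∑ φ : V → Fin m, (∏ v, volume.real (d ⁻¹' {φ v})) * g φ := by
  have hp : ∀ _ : V, IsProbabilityMeasure ((volume : Measure unitInterval).map d) :=
    fun _ => Measure.isProbabilityMeasure_map hd.aemeasurable
  have hmp : MeasurePreserving (fun (y : V → unitInterval) v => d (y v)) volume
      (Measure.pi fun _ : V => (volume : Measure unitInterval).map d) :=
    measurePreserving_pi _ _ fun _ => hd.measurePreserving _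
  rw [← integral_map (φ := fun (y : V → unitInterval) v => d (y v)) (f := g)
    hmp.measurable.aemeasurable (measurable_of_countable g).aestronglyMeasurable, hmp.map_eq,
    integral_fintype (Integrable.of_finite)]
  refine Finset.sum_congr rfl fun φ _ => ?_
  rw [smul_eq_mul, measureReal_def, Measure.pi_singleton, ENNReal.toReal_prod]
  congr 1
  refine Finset.prod_congr rfl fun v _ => ?_
  rw [Measure.map_apply hd (measurableSet_singleton _), measureReal_def]

theorem density_ofColouring {x : ℕ → unitInterval} {k m : ℕ} {d : unitInterval → Fin m}
    (hd : Measurable d) {c : unitInterval → ℕ ⊕ Fin m}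
    (hc : ∀ S : Set (ℕ ⊕ Fin m), MeasurableSet (c ⁻¹' S)) (hfin : (Set.range c).Finite)
    (hcx : ∀ i < k, c (x i) = Sum.inl i) (hcd : ∀ᵐ u, c u = Sum.inr (d u))
    (B : Sym2 (ℕ ⊕ Fin m) → ℝ) {G : PLMultigraph} (hG : G.IsLabelledBy k) :
    G.density x (Kernel.ofColouring c hc hfin B) =
      MvPolynomial.eval B (G.densityPoly fun j => volume.real (d ⁻¹' {j})) := by
  classical
  rw [eval_densityPoly, ← unitInterval.integral_comp_pi hd
    (fun φ : G.V → Fin m => ∏ e, B ((G.ends e).map (Sum.map id φ))), density]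
  refine integral_congr_ae ?_
  have hae : ∀ᵐ y : G.V → unitInterval, ∀ v, c (y v) = Sum.inr (d (y v)) :=
    eventually_all.2 fun v => (Measure.tendsto_eval_ae_ae
      (μ := fun _ : G.V => (volume : Measure unitInterval)) (i := v)).eventually hcd
  filter_upwards [hae] with y hy
  refine Finset.prod_congr rfl fun e _ => ?_
  rw [Kernel.onPair_ofColouring]
  congr 1
  refine Sym2.map_congr ?_
  rintro (i | v) hi
  · exact hcx i (hG e i hi)
  · exact hy v

/-! ### Recovering a multigraph from its leading monomial -/

/-- Families with the same multiset of values differ by a bijection of the index sets. -/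
theorem exists_equiv_of_sum_single_eq {E E' Z : Type} [Fintype E] [Fintype E'] {g : E → Z}
    {g' : E' → Z}
    (h : ∑ e, Finsupp.single (g e) 1 = ∑ e, Finsupp.single (g' e) (1 : ℕ)) :
    ∃ τ : E ≃ E', ∀ e, g' (τ e) = g e := by
  classical
  have hcard : ∀ z, Nonempty ({e // g e = z} ≃ {e // g' e = z}) := by
    intro z
    have hz := DFunLike.congr_fun h z
    simp only [Finsupp.finsetSum_apply, Finsupp.single_apply, Finset.sum_boole,
      Nat.cast_id] at hz
    refine Fintype.card_eq.1 ?_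
    rw [Fintype.card_subtype, Fintype.card_subtype, hz]
  refine ⟨(Equiv.sigmaFiberEquiv g).symm.trans ((Equiv.sigmaCongrRight fun z =>
    (hcard z).some).trans (Equiv.sigmaFiberEquiv g')), fun e => ?_⟩
  exact ((hcard (g e)).some ⟨e, rfl⟩).2

/-- If some image of `G` has the same edges as an injective image of `H`, then it covers
all nodes of the latter, as no unlabelled node is isolated. So if `G` has at most as many
unlabelled nodes as `H`, then its map is injective as well, and `G` and `H` are isomorphic. -/
theorem iso_of_edgeExponent_eq {G H : PLMultigraph} {m : ℕ} {φ : G.V → Fin m} {ψ : H.V → Fin m}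
    (hψ : Function.Injective ψ) (hcard : Fintype.card G.V ≤ Fintype.card H.V)
    (h : G.edgeExponent φ = H.edgeExponent ψ) : G.Iso H := by
  classical
  obtain ⟨τ, hτ⟩ := exists_equiv_of_sum_single_eq h
  have hmem : ∀ {K : PLMultigraph} {χ : K.V → Fin m} (j : Fin m),
      j ∈ Set.range χ ↔ ∃ e, (Sum.inr j : ℕ ⊕ Fin m) ∈ (K.ends e).map (Sum.map id χ) := by
    intro K χ j
    constructor
    · rintro ⟨v, rfl⟩
      obtain ⟨e, he⟩ := K.covered v
      exact ⟨e, Sym2.mem_map.2 ⟨_, he, rfl⟩⟩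
    · rintro ⟨e, he⟩
      obtain ⟨i | v, -, hv⟩ := Sym2.mem_map.1 he
      · simp at hv
      · exact ⟨v, by simpa using hv⟩
  have hrange : Set.range φ = Set.range ψ := by
    ext j
    rw [hmem, hmem, ← τ.exists_congr_right]
    simp only [hτ]
  have hφ : Function.Injective φ := by
    have h1 : (Finset.univ.image φ).card = Fintype.card H.V := by
      rw [← Finset.card_univ, ← Finset.card_image_of_injective _ hψ]
      congr 1
      ext j
      simpa using Set.ext_iff.1 hrange j
    rw [← Set.injOn_univ, ← Finset.coe_univ]
    refine Finset.card_image_iff.1 (le_antisymm Finset.card_image_le ?_)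
    rwa [h1]
  let σ : G.V ≃ H.V := (Equiv.ofInjective φ hφ).trans
    ((Equiv.setCongr hrange).trans (Equiv.ofInjective ψ hψ).symm)
  have hσ : ∀ v, ψ (σ v) = φ v := fun v => by
    simp [σ, Equiv.apply_ofInjective_symm]
  refine ⟨σ, τ, fun e => ?_⟩
  refine Sym2.map.injective (Sum.map_injective.2 ⟨Function.injective_id, hψ⟩) ?_
  rw [hτ, Sym2.map_map]
  exact Sym2.map_congr (by rintro (i | v) _ <;> simp [hσ])

end PLMultigraph

namespace MultigraphClass

theorem density_out (x : ℕ → unitInterval) (H : MultigraphClass) :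
    PLMultigraph.density x (Quotient.out H) = H.density x := by
  conv_rhs => rw [← Quotient.out_eq H]
  rfl

theorem isLabelledBy_out {k : ℕ} {H : MultigraphClass} (h : H.IsLabelledBy k) :
    PLMultigraph.IsLabelledBy k (Quotient.out H) := by
  rw [← Quotient.out_eq H] at h
  exact h

theorem edgeCount_out (H : MultigraphClass) :
    PLMultigraph.edgeCount (Quotient.out H) = H.edgeCount := by
  conv_rhs => rw [← Quotient.out_eq H]
  rfl

theorem mem_classes {n k : ℕ} {H : MultigraphClass} :
    H ∈ classes n k ↔ H.edgeCount = n ∧ H.IsLabelledBy k :=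
  (finite_classes n k).mem_toFinset

/-- The densities of the `k`-labelled multigraphs with `n` edges are linearly independent, if the
labelled nodes are placed at distinct points. -/
theorem eq_zero_of_sum_density_eq_zero {x : ℕ → unitInterval} (hx : Function.Injective x)
    {n k : ℕ} {a : MultigraphClass → ℝ}
    (h : ∀ f : Kernel, ∑ H ∈ classes n k, a H * H.density x f = 0) :
    ∀ H ∈ classes n k, a H = 0 := by
  classical
  by_contra! hex
  obtain ⟨d, hd, hpos⟩ := unitInterval.exists_measurable_partition (2 * n)
  obtain ⟨c, hc, hfin, hcx, hcd⟩ := unitInterval.exists_colouring hx k hd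
  set p : Fin (2 * n + 1) → ℝ := fun j => volume.real (d ⁻¹' {j}) with hp
  -- the combination of densities vanishes at all step kernels, so it is the zero polynomial
  have hpoly : ∑ H ∈ classes n k,
      a H • PLMultigraph.densityPoly (Quotient.out H) p = 0 := by
    refine MvPolynomial.funext fun B => ?_
    rw [map_sum, map_zero, ← h (Kernel.ofColouring c hc hfin B)]
    refine Finset.sum_congr rfl fun H hH => ?_
    rw [MvPolynomial.smul_eval, ← density_out, PLMultigraph.density_ofColouring hd hc hfin hcx hcd B
      (isLabelledBy_out (mem_classes.1 hH).2)]
  -- among the classes with nonzero coefficient, one with the most unlabelled nodes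
  obtain ⟨H₀, hH₀, hmax⟩ := Finset.exists_max_image ((classes n k).filter fun H => a H ≠ 0)
    (fun H => Fintype.card (Quotient.out H : PLMultigraph).V)
    (by obtain ⟨H, hH, hne⟩ := hex; exact ⟨H, Finset.mem_filter.2 ⟨hH, hne⟩⟩)
  obtain ⟨hH₀, ha₀⟩ := Finset.mem_filter.1 hH₀
  have hle := card_V_le (Quotient.out H₀)
  rw [edgeCount_out, (mem_classes.1 hH₀).1] at hle
  obtain ⟨ψ⟩ : Nonempty ((Quotient.out H₀ : PLMultigraph).V ↪ Fin (2 * n + 1)) :=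
    Function.Embedding.nonempty_of_card_le (by rw [Fintype.card_fin]; omega)
  have hcoeff := congrArg (MvPolynomial.coeff (PLMultigraph.edgeExponent _ ψ)) hpoly
  rw [MvPolynomial.coeff_sum, MvPolynomial.coeff_zero, Finset.sum_eq_single H₀] at hcoeff
  · rw [MvPolynomial.coeff_smul, smul_eq_mul, mul_eq_zero, or_iff_right ha₀,
      PLMultigraph.densityPoly, MvPolynomial.coeff_sum] at hcoeff
    refine (Finset.sum_pos' (fun φ _ => ?_) ⟨⇑ψ, Finset.mem_univ _, ?_⟩).ne' hcoeff
    · rw [MvPolynomial.coeff_monomial]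
      split_ifs
      · exact Finset.prod_nonneg fun v _ => (hpos _).le
      · exact le_rfl
    · rw [MvPolynomial.coeff_monomial, if_pos rfl]
      exact Finset.prod_pos fun v _ => hpos _
  · intro H hH hne
    by_cases haH : a H = 0
    · rw [haH, zero_smul, MvPolynomial.coeff_zero]
    rw [MvPolynomial.coeff_smul, PLMultigraph.densityPoly, MvPolynomial.coeff_sum,
      Finset.sum_eq_zero, smul_zero]
    intro φ _
    rw [MvPolynomial.coeff_monomial, if_neg]
    intro he
    refine hne ?_
    have := PLMultigraph.iso_of_edgeExponent_eq ψ.injective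
      (hmax H (Finset.mem_filter.2 ⟨hH, haH⟩)) he
    rw [← Quotient.out_eq H, ← Quotient.out_eq H₀]
    exact Quotient.sound this
  · exact fun h' => absurd hH₀ h'

end MultigraphClass

/-! ### Bounds and scaling -/

/-- The kernel `c f`. -/
def Kernel.scale (c : ℝ) (f : Kernel) : Kernel where
  toFun u v := c * f.toFun u v
  symm u v := by rw [f.symm]
  measurable := f.measurable.const_mul c
  bounded := by
    obtain ⟨C, hC⟩ := f.bounded
    refine ⟨|c| * C, fun u v => ?_⟩
    rw [abs_mul]
    exact mul_le_mul_of_nonneg_left (hC u v) (abs_nonneg c)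

theorem Kernel.onPair_scale (c : ℝ) (f : Kernel) {ι : Type} (p : ι → unitInterval) (z : Sym2 ι) :
    (f.scale c).onPair p z = c * f.onPair p z := by
  induction z with | _ a b => rfl

theorem Kernel.abs_onPair_le {f : Kernel} {C : ℝ} (hf : ∀ u v, |f.toFun u v| ≤ C) {ι : Type}
    (p : ι → unitInterval) (z : Sym2 ι) : |f.onPair p z| ≤ C := by
  induction z with | _ a b => exact hf _ _

theorem KernelBall.abs_le {s : ℝ} (f : KernelBall s) (u v : unitInterval) :
    |f.1.toFun u v| ≤ s :=
  _root_.abs_le.2 (f.2 u v)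

namespace MultigraphClass

theorem density_scale (x : ℕ → unitInterval) (H : MultigraphClass) (c : ℝ) (f : Kernel) :
    H.density x (f.scale c) = c ^ H.edgeCount * H.density x f := by
  obtain ⟨G⟩ := H
  change G.density x (f.scale c) = c ^ Fintype.card G.E * G.density x f
  simp only [PLMultigraph.density, Kernel.onPair_scale, Finset.prod_mul_distrib,
    Finset.prod_const, Finset.card_univ, integral_const_mul]

theorem abs_density_le (x : ℕ → unitInterval) (H : MultigraphClass) {f : Kernel} {C : ℝ}
    (hf : ∀ u v, |f.toFun u v| ≤ C) : |H.density x f| ≤ C ^ H.edgeCount := by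
  obtain ⟨G⟩ := H
  change ‖∫ y : G.V → unitInterval, ∏ e : G.E, f.onPair (Sum.elim x y) (G.ends e)‖ ≤
    C ^ Fintype.card G.E
  refine (norm_integral_le_of_norm_le_const (C := C ^ Fintype.card G.E)
    (Eventually.of_forall fun y => ?_)).trans (by simp)
  rw [norm_prod]
  refine (Finset.prod_le_prod (fun _ _ => norm_nonneg _) fun e _ =>
    Kernel.abs_onPair_le hf (Sum.elim x y) (G.ends e)).trans ?_
  simp

theorem density_one (x : ℕ → unitInterval) (f : Kernel) :
    (1 : MultigraphClass).density x f = 1 :=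
  PLMultigraph.density_empty x f

theorem density_mul (x : ℕ → unitInterval) (A B : MultigraphClass) (f : Kernel) :
    (A * B).density x f = A.density x f * B.density x f := by
  obtain ⟨G⟩ := A
  obtain ⟨H⟩ := B
  exact PLMultigraph.density_glue x G H f

/-- A sum over `k`-labelled classes can be taken edge count by edge count. -/
theorem hasSum_classes {k : ℕ} {φ : MultigraphClass → ℝ} (hφ : Summable φ)
    (hk : ∀ H, φ H ≠ 0 → H.IsLabelledBy k) :
    HasSum (fun n => ∑ H ∈ classes n k, φ H) (∑' H, φ H) := by
  classical
  refine ((Equiv.sigmaFiberEquiv edgeCount).hasSum_iff.2 hφ.hasSum).sigma fun n => ?_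
  change HasSum (fun H : {H : MultigraphClass // H.edgeCount = n} => φ H.1) _
  refine (hasSum_subtype_iff_indicator (s := {H : MultigraphClass | H.edgeCount = n})).2 ?_
  have h : ∑ H ∈ classes n k, φ H =
      ∑ H ∈ classes n k, {H : MultigraphClass | H.edgeCount = n}.indicator φ H :=
    Finset.sum_congr rfl fun H hH => 
      (Set.indicator_of_mem (s := {H : MultigraphClass | H.edgeCount = n})
        (mem_classes.1 hH).1 φ).symm
  rw [h]
  refine hasSum_sum_of_ne_finset_zero fun H hH => ?_
  by_contra hne
  have hH' := Set.mem_of_indicator_ne_zero hne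
  rw [Set.indicator_of_mem hH'] at hne
  exact hH (mem_classes.2 ⟨hH', hk H hne⟩)

end MultigraphClass

/-! ### Densities of formal series -/

namespace FormalSeries

open MultigraphClass

/-- The sum `∑ a_H t_x(H, f)` (zero, if it does not converge absolutely). -/
noncomputable def density (x : ℕ → unitInterval) (a : FormalSeries) (f : Kernel) : ℝ :=
  ∑' H, a.coeff H * H.density x f

/-- The part of the sum `∑ a_H t_x(H, f)` coming from the `k`-labelled classes with `n` edges. -/
noncomputable def levelDensity (x : ℕ → unitInterval) (k n : ℕ) (a : FormalSeries) (f : Kernel) :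
    ℝ :=
  ∑ H ∈ classes n k, a.coeff H * H.density x f

theorem toReal_weightedNorm_term {r : ℝ} (hr : 0 ≤ r) (a : FormalSeries) (H : MultigraphClass) :
    (‖a.coeff H‖ₑ * ENNReal.ofReal r ^ H.edgeCount).toReal = |a.coeff H| * r ^ H.edgeCount := by
  simp [ENNReal.toReal_ofReal hr]

theorem summable_of_radiusExceeds {R : ℝ≥0∞} {s : ℝ} (hs : 0 ≤ s) (hsR : ENNReal.ofReal s < R)
    {k : ℕ} {a : FormalSeries} (ha : a ∈ labelled k) (haR : a.RadiusExceeds R) :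
    Summable fun H => |a.coeff H| * s ^ H.edgeCount := by
  have hlt : ENNReal.ofReal s < a.radius := by
    rcases haR with h | h
    · exact hsR.trans h
    · rw [h]
      exact ENNReal.ofReal_lt_top
  refine (ENNReal.summable_toReal (weightedNorm_lt_top ha hlt).ne).congr fun H => ?_
  exact toReal_weightedNorm_term hs a H

theorem sum_classes_le {r : ℝ} (hr : 0 ≤ r) {C : ℝ≥0∞} (hC : C ≠ ∞) {a : FormalSeries}
    (ha : a.weightedNorm (ENNReal.ofReal r) ≤ C) (n k : ℕ) :
    ∑ H ∈ classes n k, |a.coeff H| * r ^ n ≤ C.toReal := by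
  refine le_trans (le_of_eq ?_)
    (ENNReal.toReal_mono hC ((ENNReal.sum_le_tsum (classes n k)).trans ha))
  rw [ENNReal.toReal_sum fun H _ => by finiteness]
  refine Finset.sum_congr rfl fun H hH => ?_
  rw [toReal_weightedNorm_term hr, (mem_classes.1 hH).1]

theorem norm_term_le (x : ℕ → unitInterval) {s : ℝ} (a : FormalSeries) (f : KernelBall s)
    (H : MultigraphClass) :
    ‖a.coeff H * H.density x f.1‖ ≤ |a.coeff H| * s ^ H.edgeCount := by
  rw [norm_mul]
  exact mul_le_mul_of_nonneg_left (abs_density_le x H f.abs_le) (abs_nonneg _)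

theorem abs_levelDensity_le (x : ℕ → unitInterval) {s : ℝ} (k n : ℕ) (a : FormalSeries)
    (f : KernelBall s) :
    |levelDensity x k n a f.1| ≤ ∑ H ∈ classes n k, |a.coeff H| * s ^ n := by
  refine (Finset.abs_sum_le_sum_abs _ _).trans (Finset.sum_le_sum fun H hH => ?_)
  have := norm_term_le x a f H
  rwa [(mem_classes.1 hH).1] at this

theorem levelDensity_sub (x : ℕ → unitInterval) (k n : ℕ) (a b : FormalSeries) (f : Kernel) :
    levelDensity x k n (a - b) f = levelDensity x k n a f - levelDensity x k n b f := by
  rw [levelDensity, levelDensity, levelDensity, ← Finset.sum_sub_distrib]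
  exact Finset.sum_congr rfl fun H _ => sub_mul _ _ _

theorem levelDensity_scale (x : ℕ → unitInterval) (k n : ℕ) (a : FormalSeries) (c : ℝ)
    (f : Kernel) : levelDensity x k n a (f.scale c) = c ^ n * levelDensity x k n a f := by
  rw [levelDensity, levelDensity, Finset.mul_sum]
  refine Finset.sum_congr rfl fun H hH => ?_
  rw [density_scale, (mem_classes.1 hH).1]
  ring

theorem hasSum_levelDensity (x : ℕ → unitInterval) {s : ℝ} {k : ℕ} {a : FormalSeries}
    (ha : a ∈ labelled k) (hsum : Summable fun H => |a.coeff H| * s ^ H.edgeCount)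
    (f : KernelBall s) :
    HasSum (fun n => levelDensity x k n a f.1) (density x a f.1) :=
  hasSum_classes (hsum.of_norm_bounded (norm_term_le x a f))
    fun H hH => ha H (left_ne_zero_of_mul hH)

theorem summable_level_bounds {s : ℝ} {k : ℕ} {a : FormalSeries} (ha : a ∈ labelled k)
    (hsum : Summable fun H => |a.coeff H| * s ^ H.edgeCount) :
    Summable fun n => ∑ H ∈ classes n k, |a.coeff H| * s ^ n := by
  refine (hasSum_classes hsum fun H hH => ha H fun h => hH (by simp [h])).summable.congr
    fun n => Finset.sum_congr rfl fun H hH => ?_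
  rw [(mem_classes.1 hH).1]

theorem density_monomial (x : ℕ → unitInterval) (H : MultigraphClass) (c : ℝ) (f : Kernel) :
    density x (monomial H c) f = c * H.density x f := by
  classical
  rw [density, tsum_eq_single H]
  · simp [coeff_monomial]
  · intro G hG
    simp [coeff_monomial, hG]

theorem density_mul (x : ℕ → unitInterval) {s : ℝ} {a b : FormalSeries}
    (ha : Summable fun H => |a.coeff H| * s ^ H.edgeCount)
    (hb : Summable fun H => |b.coeff H| * s ^ H.edgeCount) (f : KernelBall s) :
    density x (a * b) f.1 = density x a f.1 * density x b f.1 := by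
  have ha' := ha.of_nonneg_of_le (fun _ => norm_nonneg _) (norm_term_le x a f)
  have hb' := hb.of_nonneg_of_le (fun _ => norm_nonneg _) (norm_term_le x b f)
  rw [density, density, density, tsum_mul_tsum_of_summable_norm ha' hb']
  have hS := (Finset.HasMulAntidiagonal.sigmaMulAntidiagonalEquivProd.hasSum_iff.2
    (summable_mul_of_summable_norm ha' hb').hasSum)
  refine (HasSum.sigma (g := fun H => (a * b).coeff H * H.density x f.1) hS fun H => ?_).tsum_eq
  suffices hH : ∑ p : Finset.HasMulAntidiagonal.mulAntidiagonal H,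
      (a.coeff p.1.1 * p.1.1.density x f.1) * (b.coeff p.1.2 * p.1.2.density x f.1) =
      (a * b).coeff H * H.density x f.1 by
    rw [← hH]
    exact hasSum_fintype _
  rw [coeff_mul, Finset.sum_mul]
  refine Eq.trans ?_ (Finset.sum_coe_sort _ _)
  refine Fintype.sum_congr _ _ ?_
  rintro ⟨⟨A, B⟩, hp⟩
  rw [Finset.HasMulAntidiagonal.mem_mulAntidiagonal] at hp
  subst hp
  rw [MultigraphClass.density_mul]
  ring

theorem summable_of_mem_convergent {R : ℝ≥0∞} {s : ℝ} (hs : 0 ≤ s) (hsR : ENNReal.ofReal s < R)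
    (F : convergent R) : Summable fun H => |F.1.coeff H| * s ^ H.edgeCount := by
  obtain ⟨⟨k, hk⟩, hR⟩ := F.2
  exact summable_of_radiusExceeds hs hsR hk hR

/-- The extension of `alpha` to convergent series, by summation. -/
noncomputable def densityHom (x : ℕ → unitInterval) {s : ℝ} (hs : 0 ≤ s) {R : ℝ≥0∞}
    (hsR : ENNReal.ofReal s < R) : convergent R →ₐ[ℝ] (KernelBall s → ℝ) where
  toFun F f := density x F.1 f.1
  map_one' := funext fun f =>
    (density_monomial x 1 1 f.1).trans (by simp [density_one])
  map_mul' F G := funext fun f => density_mul x (summable_of_mem_convergent hs hsR F)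
    (summable_of_mem_convergent hs hsR G) f
  map_zero' := funext fun f => by simp [density]
  map_add' F G := funext fun f => by
    have hF := (summable_of_mem_convergent hs hsR F).of_norm_bounded (norm_term_le x F.1 f)
    have hG := (summable_of_mem_convergent hs hsR G).of_norm_bounded (norm_term_le x G.1 f)
    change density x (F.1 + G.1) f.1 = density x F.1 f.1 + density x G.1 f.1
    rw [density, density, density, ← hF.tsum_add hG]
    exact tsum_congr fun H => add_mul _ _ _
  commutes' r := funext fun f => by
    change density x (algebraMap ℝ FormalSeries r) f.1 = r
    rw [algebraMap_eq, density_monomial, density_one, mul_one]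

theorem densityHom_ofQuantumGraphs (x : ℕ → unitInterval) {s : ℝ} (hs : 0 ≤ s) {R : ℝ≥0∞}
    (hsR : ENNReal.ofReal s < R) (p : QuantumGraphs) :
    densityHom x hs hsR (ofQuantumGraphs R p) = alpha x s p := by
  induction p using MonoidAlgebra.induction_on with
  | of H =>
    funext f
    rw [MonoidAlgebra.of_apply, ofQuantumGraphs, alpha, MonoidAlgebra.lift_single,
      MonoidAlgebra.lift_single, one_smul, one_smul]
    exact (density_monomial x H 1 f.1).trans (one_mul _)
  | add p q hp hq => rw [map_add, map_add, map_add, hp, hq]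
  | smul r p hp => rw [map_smul, map_smul, map_smul, hp]

theorem coeff_ofQuantumGraphs (R : ℝ≥0∞) (p : QuantumGraphs) (H : MultigraphClass) :
    (ofQuantumGraphs R p).1.coeff H = p.coeff H := by
  classical
  induction p using MonoidAlgebra.induction_on with
  | of G =>
    rw [MonoidAlgebra.of_apply, ofQuantumGraphs, MonoidAlgebra.lift_single, one_smul]
    change (monomial G 1).coeff H = _
    rw [coeff_monomial, MonoidAlgebra.coeff_single, Finsupp.single_apply]
    simp only [eq_comm]
  | add p q hp hq =>
    rw [map_add]
    exact congrArg₂ (· + ·) hp hq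
  | smul r p hp =>
    rw [map_smul]
    exact congrArg (r * ·) hp

theorem ofQuantumGraphs_injective (R : ℝ≥0∞) : Function.Injective (ofQuantumGraphs R) := by
  intro p q h
  refine MonoidAlgebra.coeff_injective (Finsupp.ext fun H => ?_)
  rw [← coeff_ofQuantumGraphs R, h, coeff_ofQuantumGraphs]

/-! ### Uniform convergence and continuity -/

theorem tendstoUniformly_levelDensity (x : ℕ → unitInterval) {s : ℝ} {k : ℕ} {a : FormalSeries}
    (ha : a ∈ labelled k) (hsum : Summable fun H => |a.coeff H| * s ^ H.edgeCount) :
    TendstoUniformly (fun (N : ℕ) (f : KernelBall s) =>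
      ∑ n ∈ Finset.range N, levelDensity x k n a f.1) (fun f => density x a f.1) atTop := by
  have h := tendstoUniformly_tsum_nat (summable_level_bounds ha hsum)
    (f := fun n (f : KernelBall s) => levelDensity x k n a f.1)
    (fun n f => abs_levelDensity_le x k n a f)
  have heq : (fun f : KernelBall s => density x a f.1) =
      fun f => ∑' n, levelDensity x k n a f.1 :=
    funext fun f => (hasSum_levelDensity x ha hsum f).tsum_eq.symm
  rwa [heq]

theorem tendstoUniformly_levelDensity_nhds (x : ℕ → unitInterval) (s : ℝ) (k n : ℕ)
    (a : FormalSeries) :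
    TendstoUniformly (fun (b : FormalSeries) (f : KernelBall s) => levelDensity x k n b f.1)
      (fun f => levelDensity x k n a f.1) (𝓝 a) := by
  rw [Metric.tendstoUniformly_iff]
  intro ε hε
  have hcont : Continuous fun b : FormalSeries =>
      ∑ H ∈ classes n k, |(a - b).coeff H| * s ^ n := by
    refine continuous_finsetSum _ fun H _ => Continuous.mul (Continuous.abs ?_) continuous_const
    have : Continuous fun b : FormalSeries => b.coeff H := continuous_apply H
    exact continuous_const.sub this
  have h0 : ∑ H ∈ classes n k, |(a - a).coeff H| * s ^ n < ε := by simpa using hε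
  filter_upwards [hcont.continuousAt.eventually_lt continuousAt_const h0] with b hb f
  rw [Real.dist_eq, ← levelDensity_sub]
  exact (abs_levelDensity_le x k n (a - b) f).trans_lt hb

/-- On a set of series with bounded norm for a radius `r > s`, the partial sums converge uniformly
in the series and in the kernel, because the terms are bounded by `C (s / r) ^ n`. -/
theorem tendstoUniformlyOn_levelDensity (x : ℕ → unitInterval) {s r : ℝ} (hs : 0 ≤ s)
    (hsr : s < r) (k : ℕ) {C : ℝ≥0∞} (hC : C ≠ ∞) :
    TendstoUniformlyOn (fun (N : ℕ) (p : FormalSeries × KernelBall s) =>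
        ∑ n ∈ Finset.range N, levelDensity x k n p.1 p.2.1)
      (fun p => ∑' n, levelDensity x k n p.1 p.2.1) atTop
      {p | p.1.weightedNorm (ENNReal.ofReal r) ≤ C} := by
  have hr : 0 < r := hs.trans_lt hsr
  have hq : s / r < 1 := (div_lt_one hr).2 hsr
  refine tendstoUniformlyOn_tsum_nat (u := fun n => C.toReal * (s / r) ^ n)
    ((summable_geometric_of_lt_one (by positivity) hq).mul_left _) fun n p hp => ?_
  refine (abs_levelDensity_le x k n p.1 p.2).trans ?_
  have h := mul_le_mul_of_nonneg_right (sum_classes_le hr.le hC hp n k)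
    (show 0 ≤ (s / r) ^ n by positivity)
  refine le_trans (le_of_eq ?_) h
  rw [Finset.sum_mul]
  refine Finset.sum_congr rfl fun H _ => ?_
  rw [div_pow]
  field_simp

theorem continuousOn_densityHom (x : ℕ → unitInterval) {s : ℝ} (hs : 0 ≤ s) {R : ℝ≥0∞}
    (hsR : ENNReal.ofReal s < R) (k : ℕ) {r : ℝ} (hsr : s < r) {C : ℝ≥0∞} (hC : C ≠ ∞) :
    ContinuousOn (fun F : convergent R => UniformFun.ofFun (densityHom x hs hsR F))
      {F | F.1 ∈ labelled k ∧ F.1.weightedNorm (ENNReal.ofReal r) ≤ C} := by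
  intro F hF
  refine UniformFun.tendsto_iff_tendstoUniformly.2 ?_
  change TendstoUniformly (fun (G : convergent R) (f : KernelBall s) => density x G.1 f.1)
    (fun f => density x F.1 f.1) _
  rw [Metric.tendstoUniformly_iff]
  intro ε hε
  have hε3 : 0 < ε / 3 := by positivity
  obtain ⟨N, hN⟩ := ((Metric.tendstoUniformlyOn_iff.1
    (tendstoUniformlyOn_levelDensity x hs hsr k hC)) (ε / 3) hε3).exists
  have htail : ∀ G : convergent R,
      G ∈ {F : convergent R | F.1 ∈ labelled k ∧ F.1.weightedNorm (ENNReal.ofReal r) ≤ C} →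
      ∀ f : KernelBall s, dist (density x G.1 f.1)
        (∑ n ∈ Finset.range N, levelDensity x k n G.1 f.1) < ε / 3 := by
    intro G hG f
    rw [← (hasSum_levelDensity x hG.1 (summable_of_mem_convergent hs hsR G) f).tsum_eq]
    exact hN (G.1, f) hG.2
  have hpart : TendstoUniformly (fun (b : FormalSeries) (f : KernelBall s) =>
      ∑ n ∈ Finset.range N, levelDensity x k n b f.1)
      (fun f => ∑ n ∈ Finset.range N, levelDensity x k n F.1 f.1) (𝓝 F.1) := by
    clear htail hN
    induction N with
    | zero =>
      simp only [Finset.range_zero, Finset.sum_empty]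
      exact UniformContinuous.comp_tendstoUniformly (g := fun _ : ℝ => (0 : ℝ))
        uniformContinuous_const (tendstoUniformly_levelDensity_nhds x s k 0 F.1)
    | succ N ih =>
      simp only [Finset.sum_range_succ]
      exact ih.add (tendstoUniformly_levelDensity_nhds x s k N F.1)
  have hpart' := continuous_subtype_val.continuousAt.eventually
    (Metric.tendstoUniformly_iff.1 hpart (ε / 3) hε3)
  filter_upwards [mem_nhdsWithin_of_mem_nhds hpart', self_mem_nhdsWithin] with G hG hGS f
  have h1 := htail F hF f
  have h2 := hG f
  have h3 := htail G hGS f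
  rw [dist_comm] at h3
  have h4 := dist_triangle4 (density x F.1 f.1)
    (∑ n ∈ Finset.range N, levelDensity x k n F.1 f.1)
    (∑ n ∈ Finset.range N, levelDensity x k n G.1 f.1) (density x G.1 f.1)
  linarith

/-! ### Injectivity -/

theorem eq_zero_of_tsum_mul_pow_eq_zero {c : ℕ → ℝ} (hc : Summable fun n => |c n|)
    (h : ∀ t : ℝ, 0 < t → t ≤ 1 → ∑' n, c n * t ^ n = 0) (n : ℕ) : c n = 0 := by
  induction n using Nat.strong_induction_on with | _ n ih =>
  by_contra hne
  set K := ∑' i, |c (i + (n + 1))|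
  have hK : 0 ≤ K := tsum_nonneg fun _ => abs_nonneg _
  have hcs := (summable_nat_add_iff (n + 1)).2 hc
  have hpos : 0 < |c n| := abs_pos.2 hne
  -- the terms of degree greater than `n` contribute at most `K t ^ (n + 1)`
  have key : ∀ t : ℝ, 0 < t → t ≤ 1 → |c n| ≤ t * K := by
    intro t ht0 ht1
    have hb : ∀ i, ‖c (i + (n + 1)) * t ^ i‖ ≤ |c (i + (n + 1))| := fun i => by
      rw [norm_mul, Real.norm_eq_abs, norm_pow, Real.norm_of_nonneg ht0.le]
      exact mul_le_of_le_one_right (abs_nonneg _) (pow_le_one₀ ht0.le ht1)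
    have hs : Summable fun m => c m * t ^ m := hc.of_norm_bounded fun m => by
      rw [norm_mul, Real.norm_eq_abs, norm_pow, Real.norm_of_nonneg ht0.le]
      exact mul_le_of_le_one_right (abs_nonneg _) (pow_le_one₀ ht0.le ht1)
    have h1 := hs.sum_add_tsum_nat_add (n + 1)
    rw [h t ht0 ht1, Finset.sum_range_succ, Finset.sum_eq_zero fun i hi => by
      rw [ih i (Finset.mem_range.1 hi), zero_mul], zero_add] at h1
    have h2 : ∑' i, c (i + (n + 1)) * t ^ (i + (n + 1)) =
        t ^ n * (t * ∑' i, c (i + (n + 1)) * t ^ i) := by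
      rw [← mul_assoc, ← tsum_mul_left]
      exact tsum_congr fun i => by ring
    rw [h2, mul_comm (c n), ← mul_add, mul_eq_zero, or_iff_right (by positivity)] at h1
    rw [eq_neg_of_add_eq_zero_left h1, abs_neg, abs_mul, abs_of_pos ht0]
    exact mul_le_mul_of_nonneg_left (tsum_of_norm_bounded hcs.hasSum hb) ht0.le
  have ht : 0 < |c n| / (2 * (K + 1)) := by positivity
  have h1 := key (min 1 (|c n| / (2 * (K + 1)))) (lt_min one_pos ht) (min_le_left _ _)
  have h2 := h1.trans (mul_le_mul_of_nonneg_right (min_le_right _ _) hK)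
  rw [div_mul_eq_mul_div, le_div_iff₀ (by positivity)] at h2
  nlinarith

/-- A vanishing sum vanishes in every degree: rescale the kernel by `t ∈ (0, 1]` and compare the
coefficients of the resulting power series in `t`. By homogeneity this holds for every kernel, not
just for those with values in `[-s, s]`. -/
theorem levelDensity_eq_zero {x : ℕ → unitInterval} {s : ℝ} (hs : 0 < s) {k : ℕ}
    {a : FormalSeries} (ha : a ∈ labelled k)
    (hsum : Summable fun H => |a.coeff H| * s ^ H.edgeCount)
    (h : ∀ f : KernelBall s, density x a f.1 = 0) (n : ℕ) (f : Kernel) :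
    levelDensity x k n a f = 0 := by
  obtain ⟨C', hC'⟩ := f.bounded
  obtain ⟨C, hC0, hC⟩ : ∃ C, 0 < C ∧ ∀ u v, |f.toFun u v| ≤ C :=
    ⟨max C' 1, by positivity, fun u v => (hC' u v).trans (le_max_left _ _)⟩
  have hball : ∀ t : ℝ, 0 < t → t ≤ 1 →
      ∀ u v, ((f.scale (s / C)).scale t).toFun u v ∈ Set.Icc (-s) s := by
    intro t ht0 ht1 u v
    refine abs_le.1 ?_
    change |t * (s / C * f.toFun u v)| ≤ s
    rw [abs_mul, abs_mul, abs_of_pos ht0, abs_of_pos (div_pos hs hC0)]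
    calc t * (s / C * |f.toFun u v|) ≤ 1 * (s / C * C) := by
          gcongr
          exact hC u v
      _ = s := by field_simp
  have hone : (f.scale (s / C)).scale 1 = f.scale (s / C) := by simp [Kernel.scale]
  let g : KernelBall s := ⟨f.scale (s / C), hone ▸ hball 1 one_pos le_rfl⟩
  have hc := eq_zero_of_tsum_mul_pow_eq_zero (c := fun n => levelDensity x k n a g.1)
    ((summable_level_bounds ha hsum).of_nonneg_of_le (fun _ => abs_nonneg _)
      fun n => abs_levelDensity_le x k n a g) (fun t ht0 ht1 => by
        have := (hasSum_levelDensity x ha hsum ⟨g.1.scale t, hball t ht0 ht1⟩).tsum_eq.trans (h _)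
        rw [← this]
        exact tsum_congr fun m =>
          (mul_comm _ _).trans (levelDensity_scale x k m a t g.1).symm) n
  simp only [g, levelDensity_scale, mul_eq_zero] at hc
  exact hc.resolve_left (pow_pos (div_pos hs hC0) n).ne'

theorem densityHom_injective {x : ℕ → unitInterval} (hx : Function.Injective x) {s : ℝ}
    (hs : 0 < s) {R : ℝ≥0∞} (hsR : ENNReal.ofReal s < R) :
    Function.Injective (densityHom x hs.le hsR) := by
  refine (injective_iff_map_eq_zero _).2 fun F hF => Subtype.ext (ext fun H => ?_)
  obtain ⟨k, hk⟩ := F.2.1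
  by_contra hne
  refine hne (eq_zero_of_sum_density_eq_zero hx (fun f => levelDensity_eq_zero hs hk
    (summable_of_mem_convergent hs.le hsR F) (congrFun hF) H.edgeCount f) H
    (mem_classes.2 ⟨rfl, hk H hne⟩))

end FormalSeries

/-- A single edge from the node with label `i` to an unlabelled node. -/
def PLMultigraph.pendant (i : ℕ) : PLMultigraph where
  V := Unit
  E := Unit
  fintypeV := inferInstance
  fintypeE := inferInstance
  ends _ := s(Sum.inl i, Sum.inr ())
  loopless _ := by simp
  covered v := ⟨(), by simp⟩

namespace MultigraphClass

/-- Two labels at the same point cannot be told apart by densities. -/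
theorem injective_of_alpha_injective {x : ℕ → unitInterval} {s : ℝ}
    (h : Function.Injective (alpha x s)) : Function.Injective x := by
  intro i j hij
  have hd : alpha x s (MonoidAlgebra.single (mk (PLMultigraph.pendant i)) 1) =
      alpha x s (MonoidAlgebra.single (mk (PLMultigraph.pendant j)) 1) := by
    rw [alpha, MonoidAlgebra.lift_single, MonoidAlgebra.lift_single, one_smul, one_smul]
    funext f
    change ∫ y : Unit → unitInterval, ∏ _e : Unit, f.1.toFun (x i) (y ()) =
      ∫ y : Unit → unitInterval, ∏ _e : Unit, f.1.toFun (x j) (y ())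
    rw [hij]
  obtain ⟨σ, τ, hτ⟩ := Quotient.exact (MonoidAlgebra.single_left_injective one_ne_zero (h hd))
  have : (s(Sum.inl j, Sum.inr ()) : Sym2 (ℕ ⊕ Unit)) = s(Sum.inl i, Sum.inr (σ ())) := hτ ()
  rcases Sym2.eq_iff.1 this with ⟨h1, -⟩ | ⟨h1, -⟩
  · exact (Sum.inl_injective h1).symm
  · simp at h1

end MultigraphClass

theorem theorem4p12 (x : ℕ → unitInterval) (s : ℝ) (hs : 0 < s) (R : ℝ≥0∞)
    (hsR : ENNReal.ofReal s < R) :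
    ∃ A : FormalSeries.convergent R →ₐ[ℝ] (KernelBall s → ℝ),
      -- `A` extends `α_x`
      (∀ p : QuantumGraphs, A (FormalSeries.ofQuantumGraphs R p) = MultigraphClass.alpha x s p) ∧
      -- `A F` is the uniform limit of the images of the partial sums of `F`
      (∀ (k : ℕ) (F : FormalSeries.convergent R), F.1 ∈ FormalSeries.labelled k →
        TendstoUniformly
          (fun (N : ℕ) (f : KernelBall s) => ∑ n ∈ Finset.range N,
            ∑ H ∈ MultigraphClass.classes n k, F.1.coeff H * H.density x f.1)
          (A F) atTop) ∧
      -- `A` is continuous, into the topology of uniform convergence, on bounded sets of series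
      (∀ (k : ℕ) (r C : ℝ), s < r →
        ContinuousOn (fun F : FormalSeries.convergent R => UniformFun.ofFun (A F))
          {F | F.1 ∈ FormalSeries.labelled k ∧
            F.1.weightedNorm (ENNReal.ofReal r) ≤ ENNReal.ofReal C}) ∧
      -- injectivity
      (Function.Injective A ↔ Function.Injective x) ∧
      (Function.Injective (MultigraphClass.alpha x s) ↔ Function.Injective x) := by
  have hext := FormalSeries.densityHom_ofQuantumGraphs x hs.le hsR
  have hcomp : ⇑(MultigraphClass.alpha x s) =
      FormalSeries.densityHom x hs.le hsR ∘ FormalSeries.ofQuantumGraphs R :=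
    funext fun p => (hext p).symm
  have hα : Function.Injective (FormalSeries.densityHom x hs.le hsR) →
      Function.Injective (MultigraphClass.alpha x s) := fun h =>
    hcomp ▸ h.comp (FormalSeries.ofQuantumGraphs_injective R)
  refine ⟨FormalSeries.densityHom x hs.le hsR, hext, fun k F hF => ?_, fun k r C hsr => ?_,
    ⟨fun h => ?_, fun h => ?_⟩, ⟨fun h => ?_, fun h => ?_⟩⟩
  · exact FormalSeries.tendstoUniformly_levelDensity x hF
      (FormalSeries.summable_of_mem_convergent hs.le hsR F)
  · exact FormalSeries.continuousOn_densityHom x hs.le hsR k hsr ENNReal.ofReal_ne_top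
  · exact MultigraphClass.injective_of_alpha_injective (hα h)
  · exact FormalSeries.densityHom_injective h hs hsR
  · exact MultigraphClass.injective_of_alpha_injective h
  · exact hα (FormalSeries.densityHom_injective h hs hsR)
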